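/- Let $N\ge 1$ be an integer and consider the circular symplectic ensemble (CSE) of $N$ points $\zeta_1,\dots,\zeta_N$ on the unit circle, with joint density $$\frac1{Z_N}\prod_{1\le j<k\le N}|\zeta_j-\zeta_k|^{4}$$ with respect to $\prod_{j}\frac{d\zeta_j}{2\pi i\zeta_j}$, where $Z_N$ is the normalisation; write $\langle\,\cdot\,\rangle$ for the corresponding average. For $z\in\mathbb{C}$ with $|z|\ne1$ put $A(z)=\sum_{j=1}^N\frac{\zeta_j+z}{\zeta_j-z}$, and let $$W_2(z_1,z_2)=\langle A(z_1)A(z_2)\rangle-\langle A(z_1)\rangle\langle A(z_2)\rangle$$ be the second (connected) resolvent function. Let $z_1,z_2$ lie in the $(0,\infty)$ domain, i.e. $|z_1|<1<|z_2|$, and put $\zeta=z_1/z_2$, so that $|\zeta|<1$. (a) $W_2(z_1,z_2)$ depends only on $\zeta$ and $N$, and, writing $W_2(\zeta)$ for it, one has for all $N\ge1$ $$\begin{aligned} W_2(\zeta)={}&2(1-\zeta)^{-1}(1-\zeta^{2N-1})\\ &+(1-\zeta)^{-2}\Big[\zeta^2(1-\zeta^{2N-2})-2(1-\zeta^{2N-1})-\tfrac{2}{2N-1}\zeta(1-\zeta^{2N-1})\Big]\\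 &-\Big[2\zeta(1-\zeta)^{-2}+(2N+1)(1-\zeta)^{-1}\Big]\\ &\quad\times\Big[\tfrac{\zeta^2}{2N-3}\,{}_2F_1(1,\tfrac32-N;\tfrac52-N;\zeta)+\tfrac{\zeta^{2N}}{2N-1}\,{}_2F_1(1,N-\tfrac12;N+\tfrac12;\zeta)\Big], \end{aligned}$$ where ${}_2F_1$ is the Gauss hypergeometric function. (b) In the global regime, as $N\to\infty$, $$W_2(\zeta)=-\frac{2\zeta}{(\zeta-1)^2}+\sum_{r=1}^{9}\frac{(-1)^{r-1}}{2^{r-1}N^r(\zeta-1)^{r+2}}\,\zeta\,p_r(\zeta)+O(N^{-10}),$$ uniformly in $|\zeta|\le\rho$ for every fixed $\rho<1$, where $$\begin{aligned} p_1&=1+\zeta,\\ p_2&=1+4\zeta+\zeta^2,\\ p_3&=1+15\zeta+15\zeta^2+\zeta^3,\\ p_4&=1+50\zeta+138\zeta^2+50\zeta^3+\zeta^4,\\ p_5&=1+157\zeta+994\zeta^2+994\zeta^3+157\zeta^4+\zeta^5,\\ p_6&=1+480\zeta+6231\zeta^2+13456\zeta^3+6231\zeta^4+480\zeta^5+\zeta^6,\\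 p_7&=1+1451\zeta+35961\zeta^2+146907\zeta^3+146907\zeta^4+35961\zeta^5+1451\zeta^6+\zeta^7,\\ p_8&=1+4366\zeta+197224\zeta^2+1402834\zeta^3+2597230\zeta^4+1402834\zeta^5+197224\zeta^6+4366\zeta^7+\zeta^8,\\ p_9&=1+13113\zeta+1047252\zeta^2+12262436\zeta^3+38286798\zeta^4+38286798\zeta^5+12262436\zeta^6+1047252\zeta^7+13113\zeta^8+\zeta^9. \end{aligned}$$ -/

import Mathlib

open MeasureTheory

noncomputable section

namespace CircularEnsemble

/-- A configuration of `N` particles on the unit circle, by their angles in units of `2π`: the `j`-th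
particle sits at `exp (2 π i t j)`, with `t j ∈ ℝ / ℤ`. -/
abbrev Config (N : ℕ) : Type := Fin N → UnitAddCircle

/-- The reference measure `∏ⱼ dζⱼ / (2 π i ζⱼ) = ∏ⱼ dθⱼ / (2 π)`, i.e. the product of the normalised
arc length (Haar probability) measures of the `N` circles. -/
def refMeasure (N : ℕ) : Measure (Config N) :=
  Measure.pi fun _ : Fin N => (AddCircle.haarAddCircle : Measure UnitAddCircle)

/-- The position `ζⱼ = exp (2 π i t j)` of the `j`-th particle in the complex plane. -/
def pos {N : ℕ} (t : Config N) (j : Fin N) : ℂ := (AddCircle.toCircle (t j) : ℂ)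

/-- The unnormalised density `∏_{j < k} |ζⱼ - ζₖ| ^ (2 κ)` of the Dyson circular ensemble with
inverse temperature `β = 2 κ` and no external potential. -/
def density (N : ℕ) (κ : ℝ) (t : Config N) : ℝ :=
  ∏ j : Fin N, ∏ k ∈ Finset.Ioi j, ‖pos t j - pos t k‖ ^ (2 * κ)

/-- The normalisation `Z_N`. -/
def partitionFunction (N : ℕ) (κ : ℝ) : ℝ :=
  ∫ t, density N κ t ∂(refMeasure N)

/-- The ensemble average `⟨f⟩`, with `⟨1⟩ = 1`. -/
def average (N : ℕ) (κ : ℝ) (f : Config N → ℂ) : ℂ :=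
  (∫ t, f t * (density N κ t : ℂ) ∂(refMeasure N)) / (partitionFunction N κ : ℂ)

/-- The linear statistic `∑ⱼ (ζⱼ + z) / (ζⱼ - z)` of the Riesz-Herglotz kernel. -/
def herglotzSum {N : ℕ} (z : ℂ) (t : Config N) : ℂ :=
  ∑ j : Fin N, (pos t j + z) / (pos t j - z)

/-- The second connected resolvent function `W₂(z₁, z₂)`: the second joint cumulant
`⟨A B⟩ - ⟨A⟩ ⟨B⟩` of the Riesz-Herglotz statistics at `z₁` and at `z₂`. -/
def W₂ (N : ℕ) (κ : ℝ) (z₁ z₂ : ℂ) : ℂ :=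
  average N κ (fun t => herglotzSum z₁ t * herglotzSum z₂ t)
    - average N κ (herglotzSum z₁) * average N κ (herglotzSum z₂)

/-- The closed form, as a function of `ζ`, with Gauss hypergeometric functions `₂F₁`. -/
def cseClosedForm (N : ℕ) (ζ : ℂ) : ℂ :=
  2 * (1 - ζ)⁻¹ * (1 - ζ ^ (2 * N - 1))
    + ((1 - ζ) ^ 2)⁻¹ *
      (ζ ^ 2 * (1 - ζ ^ (2 * N - 2)) - 2 * (1 - ζ ^ (2 * N - 1))
        - 2 / (2 * (N : ℂ) - 1) * ζ * (1 - ζ ^ (2 * N - 1)))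
    - (2 * ζ * ((1 - ζ) ^ 2)⁻¹ + (2 * (N : ℂ) + 1) * (1 - ζ)⁻¹) *
      (ζ ^ 2 / (2 * (N : ℂ) - 3) * ₂F₁ (1 : ℂ) (3 / 2 - (N : ℂ)) (5 / 2 - (N : ℂ)) ζ
        + ζ ^ (2 * N) / (2 * (N : ℂ) - 1) * ₂F₁ (1 : ℂ) ((N : ℂ) - 1 / 2) ((N : ℂ) + 1 / 2) ζ)

/-- The large `N` expansion in the global regime, through order `N ^ (-9)`. -/
def cseGlobalExpansion (N : ℕ) (ζ : ℂ) : ℂ :=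
  - (2 * ζ) / (ζ - 1) ^ 2
  + 1 / (N * (ζ - 1) ^ 3) * ζ * (1 + ζ)
  - 1 / (2 * N ^ 2 * (ζ - 1) ^ 4) * ζ * (1 + 4 * ζ + ζ ^ 2)
  + 1 / (4 * N ^ 3 * (ζ - 1) ^ 5) * ζ * (1 + 15 * ζ + 15 * ζ ^ 2 + ζ ^ 3)
  - 1 / (8 * N ^ 4 * (ζ - 1) ^ 6) * ζ * (1 + 50 * ζ + 138 * ζ ^ 2 + 50 * ζ ^ 3 + ζ ^ 4)
  + 1 / (16 * N ^ 5 * (ζ - 1) ^ 7) * ζ *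
      (1 + 157 * ζ + 994 * ζ ^ 2 + 994 * ζ ^ 3 + 157 * ζ ^ 4 + ζ ^ 5)
  - 1 / (32 * N ^ 6 * (ζ - 1) ^ 8) * ζ *
      (1 + 480 * ζ + 6231 * ζ ^ 2 + 13456 * ζ ^ 3 + 6231 * ζ ^ 4 + 480 * ζ ^ 5 + ζ ^ 6)
  + 1 / (64 * N ^ 7 * (ζ - 1) ^ 9) * ζ *
      (1 + 1451 * ζ + 35961 * ζ ^ 2 + 146907 * ζ ^ 3 + 146907 * ζ ^ 4
        + 35961 * ζ ^ 5 + 1451 * ζ ^ 6 + ζ ^ 7)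
  - 1 / (128 * N ^ 8 * (ζ - 1) ^ 10) * ζ *
      (1 + 4366 * ζ + 197224 * ζ ^ 2 + 1402834 * ζ ^ 3 + 2597230 * ζ ^ 4
        + 1402834 * ζ ^ 5 + 197224 * ζ ^ 6 + 4366 * ζ ^ 7 + ζ ^ 8)
  + 1 / (256 * N ^ 9 * (ζ - 1) ^ 11) * ζ *
      (1 + 13113 * ζ + 1047252 * ζ ^ 2 + 12262436 * ζ ^ 3 + 38286798 * ζ ^ 4
        + 38286798 * ζ ^ 5 + 12262436 * ζ ^ 6 + 1047252 * ζ ^ 7 + 13113 * ζ ^ 8 + ζ ^ 9)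

end CircularEnsemble

end

/-!
On `|z₁| < 1 < |z₂|` the Herglotz sums expand into power sums of the particles, and rotation
invariance kills all mixed moments except those of opposite frequencies, so `W₂` is `-4` times the
generating function, at `ζ = z₁ / z₂`, of the structure factors `S k = ⟨|∑ⱼ ζⱼ ^ k|²⟩`.

For `β = 4` the density is a confluent Vandermonde determinant of size `2 N`, whose frequencies are
the odd multiples of `1 / 2` below `N`. Its averages are therefore signed sums over the ways of
pairing frequencies with prescribed total in each pair. Perfect pairings put opposite frequencies
together, and a pairing with totals `-k` and `k` on two pairs is matched with them by exchanging
partners. This gives `S k = (min k (2 N) + k H) / 2`, where `H` is the sum of `1 / (2 N - 1 - 2 e)`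
over `e < min k (2 N)`.

The generating function is then a sum of derivatives and Cauchy products of the polynomial
`∑ ζ ^ e / (2 N - 1 - 2 e)`, `e < 2 N`, which is a difference of tails of the full series, and these
tails are the hypergeometric functions. Expanding `1 / (2 N - 1 - 2 e)` in powers of `1 / N` brings
in power sums of odd numbers, whose generating functions have type B Eulerian numerators.
-/

noncomputable section

namespace CircularEnsemble

section PairSum

open Equiv

variable {ι R : Type*} [DecidableEq ι]

/-- The exchange of the two slots of the site `i`. -/
def slotSwap (i : ι) : Perm (ι ⊕ ι) := swap (.inl i) (.inr i)

lemma slotSwap_apply_of_ne {i j : ι} (h : j ≠ i) :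
    slotSwap i (.inl j) = .inl j ∧ slotSwap i (.inr j) = .inr j := by
  constructor <;> apply swap_apply_of_ne_of_ne <;> simp [h]

@[simp] lemma slotSwap_inl (i : ι) : slotSwap i (.inl i) = .inr i := swap_apply_left _ _

@[simp] lemma slotSwap_inr (i : ι) : slotSwap i (.inr i) = .inl i := swap_apply_right _ _

variable [Fintype ι] [CommRing R]

/-- The summand `sign σ * ∏ i, φ i (σ (inl i)) (σ (inr i))` of a signed sum over all ways of filling
the slots `inl i` and `inr i` of every site `i` with the elements of `ι ⊕ ι`. -/
def pairTerm (φ : ι → ι ⊕ ι → ι ⊕ ι → R) (σ : Perm (ι ⊕ ι)) : R :=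
  ((Perm.sign σ : ℤ) : R) * ∏ i, φ i (σ (.inl i)) (σ (.inr i))

/-- The signed pair sum of `φ`. If all the `φ i` are equal to one alternating `f`, this is
`2 ^ N * N !` times the Pfaffian of `f`, where `N` is the number of sites. -/
def pairSum (φ : ι → ι ⊕ ι → ι ⊕ ι → R) : R :=
  ∑ σ, pairTerm φ σ

lemma pairTerm_mul_slotSwap (φ : ι → ι ⊕ ι → ι ⊕ ι → R) (σ : Perm (ι ⊕ ι)) (i : ι) :
    pairTerm φ (σ * slotSwap i) = -pairTerm (Function.update φ i fun a b => φ i b a) σ := by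
  have hprod : ∏ j, φ j ((σ * slotSwap i) (.inl j)) ((σ * slotSwap i) (.inr j))
      = ∏ j, Function.update φ i (fun a b => φ i b a) j (σ (.inl j)) (σ (.inr j)) := by
    refine Finset.prod_congr rfl fun j _ => ?_
    rcases eq_or_ne j i with rfl | hj
    · simp
    · simp [slotSwap_apply_of_ne hj, Function.update_of_ne hj]
  rw [pairTerm, pairTerm, hprod, Perm.sign_mul, slotSwap, Perm.sign_swap Sum.inl_ne_inr]
  simp

lemma pairTerm_mul_slotSwap_of_alternating {φ : ι → ι ⊕ ι → ι ⊕ ι → R} {i : ι}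
    (hφ : ∀ a b, φ i b a = -φ i a b) (σ : Perm (ι ⊕ ι)) :
    pairTerm φ (σ * slotSwap i) = pairTerm φ σ := by
  rw [pairTerm_mul_slotSwap, pairTerm, pairTerm,
    ← Finset.mul_prod_erase _ (fun j => φ j _ _) (Finset.mem_univ i),
    ← Finset.mul_prod_erase _ (fun j => Function.update φ i _ j _ _) (Finset.mem_univ i),
    Function.update_self, hφ, Finset.prod_congr rfl fun j hj => by
      rw [Function.update_of_ne (Finset.ne_of_mem_erase hj)]]
  ring

lemma pairSum_update_antisymmetrize (φ : ι → ι ⊕ ι → ι ⊕ ι → R) (i : ι) :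
    pairSum (Function.update φ i fun a b => φ i a b - φ i b a) = 2 * pairSum φ := by
  have hsplit : ∀ σ, pairTerm (Function.update φ i fun a b => φ i a b - φ i b a) σ
      = pairTerm φ σ + pairTerm φ (σ * slotSwap i) := by
    intro σ
    rw [pairTerm_mul_slotSwap, pairTerm, pairTerm, pairTerm,
      ← Finset.mul_prod_erase _ (fun j => φ j _ _) (Finset.mem_univ i)]
    simp only [← Finset.mul_prod_erase _ (fun j => Function.update φ i _ j _ _) (Finset.mem_univ i),
      Function.update_self]
    have hrest : ∀ f, ∏ j ∈ Finset.univ.erase i,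
        Function.update φ i f j (σ (.inl j)) (σ (.inr j))
          = ∏ j ∈ Finset.univ.erase i, φ j (σ (.inl j)) (σ (.inr j)) := fun f =>
      Finset.prod_congr rfl fun j hj => by
        rw [Function.update_of_ne (Finset.ne_of_mem_erase hj)]
    rw [hrest, hrest]
    ring
  simp only [pairSum, hsplit, Finset.sum_add_distrib]
  rw [two_mul]
  exact congrArg _ (Equiv.sum_comp (Equiv.mulRight (slotSwap i)) (pairTerm φ))

lemma two_pow_mul_pairSum (φ : ι → ι ⊕ ι → ι ⊕ ι → R) :
    2 ^ Fintype.card ι * pairSum φ = pairSum fun i a b => φ i a b - φ i b a := by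
  suffices h : ∀ s : Finset ι, 2 ^ s.card * pairSum φ
      = pairSum fun i a b => if i ∈ s then φ i a b - φ i b a else φ i a b by
    simpa using h Finset.univ
  intro s
  induction s using Finset.induction_on with
  | empty => simp
  | insert i s hi ih =>
    rw [Finset.card_insert_of_notMem hi, pow_succ', mul_assoc, ih,
      ← pairSum_update_antisymmetrize _ i]
    congr 1
    funext j a b
    rcases eq_or_ne j i with rfl | hj
    · simp [hi]
    · simp [hj]

end PairSum

section PairCoeff

open Equiv

/-- The total frequencies of the sites after a transfer of `k` from the site `j` to the site `l`. -/
abbrev transfer {ι A : Type*} [DecidableEq ι] [AddGroup A] (k : A) (j l : ι) : ι → A :=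
  Pi.single j (-k) + Pi.single l k

lemma transfer_of_ne {ι A : Type*} [DecidableEq ι] [AddGroup A] (k : A) {i j l : ι} (hj : i ≠ j)
    (hl : i ≠ l) : transfer k j l i = 0 := by
  simp [hj, hl]

variable {ι 𝕜 : Type*} [Field 𝕜]

lemma sum_mul_comp_slotSwap [Fintype ι] [DecidableEq ι] {F : Perm (ι ⊕ ι) → 𝕜} {i : ι}
    (hF : ∀ σ, F (σ * slotSwap i) = F σ) (G : Perm (ι ⊕ ι) → 𝕜) :
    ∑ σ, F σ * G (σ * slotSwap i) = ∑ σ, F σ * G σ := by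
  rw [← Equiv.sum_comp (Equiv.mulRight (slotSwap i)) fun σ => F σ * G σ]
  simp [hF]

variable [DecidableEq 𝕜]

/-- The coefficient `d b - d a` of the pairs `a, b` with `d a + d b = c`, extended by zero. -/
def pairCoeff (d : ι ⊕ ι → 𝕜) (c : 𝕜) (a b : ι ⊕ ι) : 𝕜 :=
  if d a + d b = c then d b - d a else 0

/-- The relative weight of a term of `pairSum` after two opposite pairs `a, -a` and `b, -b` with
`a + b = k` have been broken up into the pairs `a, b` and `-a, -b`. -/
def exchangeWeight (k a b : 𝕜) : 𝕜 :=
  if a + b = k then (a - b) ^ 2 / (2 * a * b) else 0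

lemma pairCoeff_alternating (d : ι ⊕ ι → 𝕜) (c : 𝕜) (a b : ι ⊕ ι) :
    pairCoeff d c b a = -pairCoeff d c a b := by
  simp only [pairCoeff, add_comm (d b)]
  split_ifs <;> simp

variable [Fintype ι] [DecidableEq ι] {d : ι ⊕ ι → 𝕜} {k : 𝕜} {j l : ι}

lemma add_eq_of_pairTerm_ne_zero {c : ι → 𝕜} {σ : Perm (ι ⊕ ι)}
    (h : pairTerm (fun i => pairCoeff d (c i)) σ ≠ 0) (i : ι) :
    d (σ (.inl i)) + d (σ (.inr i)) = c i := by
  contrapose! h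
  rw [pairTerm, Finset.prod_eq_zero (Finset.mem_univ i) (if_neg h), mul_zero]

lemma slot_opposite_of_pairTerm_ne_zero [CharZero 𝕜] (hd : Function.Injective d)
    (hneg : ∀ s, ∃ t, d t = -d s) (h0 : ∀ s, d s ≠ 0) (hk : k ≠ 0) (hjl : j ≠ l)
    {σ : Perm (ι ⊕ ι)} (hσ : pairTerm (fun i => pairCoeff d (transfer k j l i)) σ ≠ 0) :
    d (σ (.inl l)) = -d (σ (.inl j)) ∨ d (σ (.inr l)) = -d (σ (.inl j)) := by
  have hsum := add_eq_of_pairTerm_ne_zero hσ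
  have hinj : ∀ u v, d (σ u) = d (σ v) → u = v := fun u v h => σ.injective (hd h)
  obtain ⟨t, ht⟩ := hneg (σ (.inl j))
  obtain ⟨u, rfl⟩ := σ.surjective t
  have hsite : u = .inl l ∨ u = .inr l := by
    by_contra! hu
    rcases u with i | i <;> rcases eq_or_ne i j with rfl | hij
    · exact h0 _ (CharZero.eq_neg_self_iff.1 ht)
    · have := hsum i
      rw [transfer_of_ne k hij (by simpa using hu.1), ht, neg_add_eq_zero] at this
      cases hinj _ _ this
    · have := hsum i
      simp [ht, hjl, eq_comm, hk] at this
    · have := hsum i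
      rw [transfer_of_ne k hij (by simpa using hu.2), ht, add_neg_eq_zero] at this
      exact hij (Sum.inl_injective (hinj _ _ this))
  rcases hsite with rfl | rfl
  exacts [.inl ht, .inr ht]

lemma pairTerm_eq_mul_prod_erase (c : ι → 𝕜) (hjl : j ≠ l) (hc : ∀ i, i ≠ j → i ≠ l → c i = 0)
    (σ : Perm (ι ⊕ ι)) :
    pairTerm (fun i => pairCoeff d (c i)) σ
      = ((Perm.sign σ : ℤ) : 𝕜) * pairCoeff d (c j) (σ (.inl j)) (σ (.inr j))
        * pairCoeff d (c l) (σ (.inl l)) (σ (.inr l))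
        * ∏ i ∈ (Finset.univ.erase j).erase l, pairCoeff d 0 (σ (.inl i)) (σ (.inr i)) := by
  rw [pairTerm, ← Finset.mul_prod_erase _ _ (Finset.mem_univ j),
    ← Finset.mul_prod_erase _ _ (Finset.mem_erase.2 ⟨hjl.symm, Finset.mem_univ l⟩),
    Finset.prod_congr rfl fun i hi => ?_]
  · ring
  · obtain ⟨hil, hij, -⟩ : i ≠ l ∧ i ≠ j ∧ i ∈ Finset.univ := by simpa using hi
    rw [hc i hij hil]

/-- Breaking up the opposite pairs `α, β` and `γ, δ` into `α, γ` and `β, δ`; the sign is that of the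
transposition of `β` and `γ`. -/
lemma two_mul_exchange [CharZero 𝕜] {α β γ δ : 𝕜} (hβ : β ≠ 0) (hδ : δ ≠ 0) :
    2 * ((if α + γ = -k then γ - α else 0) * (if β + δ = k then δ - β else 0)
        * if β = -α then 1 else 0)
      = -((if α + β = 0 then β - α else 0) * (if γ + δ = 0 then δ - γ else 0)
        * exchangeWeight k β δ) := by
  rw [exchangeWeight]
  by_cases hαβ : α = -β
  · by_cases hk : β + δ = k
    · by_cases hγδ : γ = -δ
      · subst hαβ hk hγδ
        rw [if_pos (neg_neg β).symm, if_pos (by ring), if_pos rfl, if_pos (neg_add_cancel β),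
          if_pos (neg_add_cancel δ), if_pos rfl]
        field_simp
        ring
      · have hαγ : α + γ ≠ -k := fun h => hγδ (by linear_combination h - hαβ + hk)
        simp [hαγ, add_eq_zero_iff_eq_neg, hγδ]
    · simp [hk]
  · have hβα : β ≠ -α := fun h => hαβ (by rw [h, neg_neg])
    simp [hβα, add_eq_zero_iff_eq_neg, hαβ]

lemma pairTerm_transfer_mul_swap [CharZero 𝕜] (h0 : ∀ s, d s ≠ 0) (hjl : j ≠ l)
    (σ : Perm (ι ⊕ ι)) :
    2 * (pairTerm (fun i => pairCoeff d (transfer k j l i)) (σ * swap (.inr j) (.inl l))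
        * if d (σ (.inr j)) = -d (σ (.inl j)) then 1 else 0)
      = pairTerm (fun _ => pairCoeff d 0) σ
        * exchangeWeight k (d (σ (.inr j))) (d (σ (.inr l))) := by
  set τ := σ * swap (.inr j) (.inl l) with hτ
  obtain ⟨hjj, hjl', hlj, hll⟩ : τ (.inl j) = σ (.inl j) ∧ τ (.inr j) = σ (.inl l)
      ∧ τ (.inl l) = σ (.inr j) ∧ τ (.inr l) = σ (.inr l) := by
    simp [hτ, hjl, hjl.symm, swap_apply_of_ne_of_ne]
  have hrest : ∏ i ∈ (Finset.univ.erase j).erase l, pairCoeff d 0 (τ (.inl i)) (τ (.inr i))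
      = ∏ i ∈ (Finset.univ.erase j).erase l, pairCoeff d 0 (σ (.inl i)) (σ (.inr i)) := by
    refine Finset.prod_congr rfl fun i hi => ?_
    obtain ⟨hil, hij⟩ : i ≠ l ∧ i ≠ j := by simpa using hi
    simp [hτ, swap_apply_of_ne_of_ne, hil, hij]
  have hsign : ((Perm.sign τ : ℤ) : 𝕜) = -((Perm.sign σ : ℤ) : 𝕜) := by
    simp [hτ, Perm.sign_mul]
  rw [pairTerm_eq_mul_prod_erase _ hjl fun i => transfer_of_ne k,
    pairTerm_eq_mul_prod_erase (fun _ => 0) hjl fun _ _ _ => rfl, hrest, hjj, hjl', hlj, hll, hsign]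
  have hexchange := two_mul_exchange (α := d (σ (.inl j))) (γ := d (σ (.inl l))) (k := k)
    (h0 (σ (.inr j))) (h0 (σ (.inr l)))
  simp only [pairCoeff, Pi.add_apply, Pi.single_eq_same, Pi.single_eq_of_ne hjl,
    Pi.single_eq_of_ne hjl.symm, add_zero, zero_add]
  linear_combination -((Perm.sign σ : ℤ) : 𝕜)
    * (∏ i ∈ (Finset.univ.erase j).erase l,
        if d (σ (.inl i)) + d (σ (.inr i)) = 0 then d (σ (.inr i)) - d (σ (.inl i)) else 0)
    * hexchange

/-- A term with the transfer `k` pairs the opposite of the first slot of `j` with one of the two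
slots of `l`, and both choices contribute equally. -/
lemma pairSum_transfer [CharZero 𝕜] (hd : Function.Injective d) (hneg : ∀ s, ∃ t, d t = -d s)
    (h0 : ∀ s, d s ≠ 0) (hk : k ≠ 0) (hjl : j ≠ l) :
    pairSum (fun i => pairCoeff d (transfer k j l i))
      = ∑ σ, pairTerm (fun _ => pairCoeff d 0) σ
        * exchangeWeight k (d (σ (.inr j))) (d (σ (.inr l))) := by
  set F := pairTerm (fun i => pairCoeff d (transfer k j l i)) with hF
  set G : Perm (ι ⊕ ι) → 𝕜 := fun σ => if d (σ (.inl l)) = -d (σ (.inl j)) then 1 else 0 with hG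
  have hG' : ∀ σ, G (σ * slotSwap l) = if d (σ (.inr l)) = -d (σ (.inl j)) then 1 else 0 := by
    simp [hG, slotSwap_apply_of_ne hjl]
  have hcases : ∀ σ, F σ = F σ * G σ + F σ * G (σ * slotSwap l) := by
    intro σ
    by_cases hσ : F σ = 0
    · simp [hσ]
    have hne : d (σ (.inr l)) ≠ d (σ (.inl l)) := fun h => by simpa using hd h
    rw [hG']
    rcases slot_opposite_of_pairTerm_ne_zero hd hneg h0 hk hjl hσ with h | h
    · simp [hG, h, h ▸ hne]
    · simp [hG, h, h ▸ hne.symm]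
  have hinv : ∀ σ, F (σ * slotSwap l) = F σ :=
    pairTerm_mul_slotSwap_of_alternating fun a b => pairCoeff_alternating d _ a b
  calc ∑ σ, F σ = 2 * ∑ σ, F σ * G σ := by
        rw [Finset.sum_congr rfl fun σ _ => hcases σ, Finset.sum_add_distrib,
          sum_mul_comp_slotSwap hinv, two_mul]
    _ = 2 * ∑ σ, F (σ * swap (.inr j) (.inl l)) * G (σ * swap (.inr j) (.inl l)) := by
        rw [← Equiv.sum_comp (Equiv.mulRight (swap (.inr j) (.inl l))) fun σ => F σ * G σ]
        rfl
    _ = _ := by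
        rw [Finset.mul_sum]
        refine Finset.sum_congr rfl fun σ _ => ?_
        rw [← pairTerm_transfer_mul_swap h0 hjl σ]
        simp only [hF, hG, Perm.mul_apply, swap_apply_right,
          swap_apply_of_ne_of_ne Sum.inl_ne_inr (Sum.inl_injective.ne hjl)]

/-- The total exchange weight of the two slots of `j` with the two slots of `l`. -/
def siteExchangeWeight (d : ι ⊕ ι → 𝕜) (k : 𝕜) (σ : Perm (ι ⊕ ι)) (j l : ι) : 𝕜 :=
  exchangeWeight k (d (σ (.inl j))) (d (σ (.inl l)))
    + exchangeWeight k (d (σ (.inl j))) (d (σ (.inr l)))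
    + (exchangeWeight k (d (σ (.inr j))) (d (σ (.inl l)))
      + exchangeWeight k (d (σ (.inr j))) (d (σ (.inr l))))

lemma sum_pairTerm_mul_siteExchangeWeight_of_ne (hjl : j ≠ l) :
    ∑ σ, pairTerm (fun _ => pairCoeff d 0) σ * siteExchangeWeight d k σ j l
      = 4 * ∑ σ, pairTerm (fun _ => pairCoeff d 0) σ
        * exchangeWeight k (d (σ (.inr j))) (d (σ (.inr l))) := by
  have hinv : ∀ i σ, pairTerm (fun _ => pairCoeff d 0) (σ * slotSwap i)
      = pairTerm (fun _ => pairCoeff d 0) σ := fun i =>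
    pairTerm_mul_slotSwap_of_alternating fun a b => pairCoeff_alternating d 0 a b
  have hj := fun s => sum_mul_comp_slotSwap (hinv j) fun σ =>
    exchangeWeight k (d (σ (.inr j))) (d (σ s))
  have hl := sum_mul_comp_slotSwap (hinv l) fun σ =>
    exchangeWeight k (d (σ (.inr j))) (d (σ (.inr l)))
  simp only [Perm.mul_apply, slotSwap_inr, (slotSwap_apply_of_ne hjl).2] at hj hl
  have hjl' := hj (.inl l)
  have hjr := hj (.inr l)
  rw [(slotSwap_apply_of_ne hjl.symm).1] at hjl'
  rw [(slotSwap_apply_of_ne hjl.symm).2] at hjr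
  simp only [siteExchangeWeight, mul_add, Finset.sum_add_distrib, hjl', hjr, hl]
  ring

lemma pairTerm_mul_siteExchangeWeight_self (hk : k ≠ 0) (σ : Perm (ι ⊕ ι)) (j : ι) :
    pairTerm (fun _ => pairCoeff d 0) σ * siteExchangeWeight d k σ j j = 0 := by
  by_cases hσ : pairTerm (fun _ => pairCoeff d 0) σ = 0
  · rw [hσ, zero_mul]
  have hopp := add_eq_of_pairTerm_ne_zero hσ j
  simp [siteExchangeWeight, exchangeWeight, hopp, add_comm (d (σ (.inr j))), hk.symm]

theorem sum_pairSum_transfer [CharZero 𝕜] (hd : Function.Injective d)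
    (hneg : ∀ s, ∃ t, d t = -d s) (h0 : ∀ s, d s ≠ 0) (hk : k ≠ 0) :
    ∑ j, ∑ l, pairSum (fun i => pairCoeff d (transfer k j l i))
      = (Fintype.card ι + (∑ s, ∑ t, exchangeWeight k (d s) (d t)) / 4)
        * pairSum fun _ => pairCoeff d 0 := by
  have hsite : ∀ j l, pairSum (fun i => pairCoeff d (transfer k j l i))
      = (if j = l then pairSum fun _ => pairCoeff d 0 else 0)
        + (∑ σ, pairTerm (fun _ => pairCoeff d 0) σ * siteExchangeWeight d k σ j l) / 4 := by
    intro j l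
    rcases eq_or_ne j l with rfl | hjl
    · have : transfer k j j = 0 := by
        rw [transfer, ← Pi.single_add, neg_add_cancel, Pi.single_zero]
      simp only [this, Pi.zero_apply, pairTerm_mul_siteExchangeWeight_self hk,
        Finset.sum_const_zero, if_true, zero_div, add_zero]
    · rw [pairSum_transfer hd hneg h0 hk hjl, sum_pairTerm_mul_siteExchangeWeight_of_ne hjl,
        if_neg hjl, zero_add, mul_div_cancel_left₀ _ (by norm_num)]
  have htotal : ∑ j, ∑ l, ∑ σ, pairTerm (fun _ => pairCoeff d 0) σ * siteExchangeWeight d k σ j l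
      = (∑ s, ∑ t, exchangeWeight k (d s) (d t)) * pairSum fun _ => pairCoeff d 0 := by
    have hperm : ∀ σ : Perm (ι ⊕ ι), ∑ s, ∑ t, exchangeWeight k (d s) (d t)
        = ∑ s, ∑ t, exchangeWeight k (d (σ s)) (d (σ t)) := fun σ => by
      rw [← Equiv.sum_comp σ]
      exact Finset.sum_congr rfl fun s _ => (Equiv.sum_comp σ _).symm
    rw [pairSum, Finset.mul_sum, Finset.sum_congr rfl fun j _ => Finset.sum_comm,
      Finset.sum_comm]
    refine Finset.sum_congr rfl fun σ _ => ?_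
    rw [hperm σ]
    simp only [siteExchangeWeight, ← Finset.mul_sum, Fintype.sum_sum_type, Finset.sum_add_distrib]
    ring
  simp only [hsite, Finset.sum_add_distrib, ← Finset.sum_div, htotal, Finset.sum_ite_eq,
    Finset.mem_univ, if_true, Finset.sum_const, Finset.card_univ, nsmul_eq_mul]
  ring

end PairCoeff

section PairSumAlgebra

variable {ι R S : Type*} [Fintype ι] [DecidableEq ι] [CommRing R] [CommRing S]

lemma pairSum_mul_left (c : ι → R) (φ : ι → ι ⊕ ι → ι ⊕ ι → R) :
    pairSum (fun i a b => c i * φ i a b) = (∏ i, c i) * pairSum φ := by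
  simp only [pairSum, pairTerm, Finset.prod_mul_distrib, Finset.mul_sum]
  exact Finset.sum_congr rfl fun σ _ => by ring

lemma map_pairSum (f : R →+* S) (φ : ι → ι ⊕ ι → ι ⊕ ι → R) :
    f (pairSum φ) = pairSum fun i a b => f (φ i a b) := by
  simp [pairSum, pairTerm]

end PairSumAlgebra

section ConfluentVandermonde

open Matrix Polynomial

variable {N : ℕ} {R : Type*} [CommRing R]

/-- The exponent `0, …, 2 N - 1` of a column of the Vandermonde matrix in `2 N` variables. -/
def colExp (s : Fin N ⊕ Fin N) : ℕ := (finSumFinEquiv s : Fin (N + N))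

/-- The Vandermonde matrix in the `2 N` variables `x` and `y`. -/
def doubleVandermonde (x y : Fin N → R) : Matrix (Fin N ⊕ Fin N) (Fin N ⊕ Fin N) R :=
  of fun s t => Sum.elim x y s ^ colExp t

lemma prod_Ioi_eq_prod_ite {n : ℕ} (f : Fin n → Fin n → R) :
    ∏ i, ∏ j ∈ Finset.Ioi i, f i j = ∏ i, ∏ j, if i < j then f i j else 1 :=
  Finset.prod_congr rfl fun i _ => by rw [← Finset.prod_filter, Finset.filter_lt_eq_Ioi]

lemma det_doubleVandermonde (x y : Fin N → R) :
    (doubleVandermonde x y).det =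
      (∏ i, ∏ j ∈ Finset.Ioi i, (x j - x i)) * (∏ i, ∏ j ∈ Finset.Ioi i, (y j - y i)) *
        ∏ i, ∏ j, (y j - x i) := by
  have hsub : doubleVandermonde x y
      = (vandermonde (Sum.elim x y ∘ finSumFinEquiv.symm)).submatrix
          finSumFinEquiv finSumFinEquiv := by
    ext s t
    simp [doubleVandermonde, colExp, vandermonde_apply]
  rw [hsub, det_submatrix_equiv_self, det_vandermonde]
  have hxy : ∀ i j : Fin N, Fin.castAdd N i < Fin.natAdd N j := fun i j => by
    simp only [Fin.lt_def, Fin.val_castAdd, Fin.val_natAdd]; omega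
  have hyx : ∀ i j : Fin N, ¬ Fin.natAdd N i < Fin.castAdd N j := fun i j => (hxy j i).not_gt
  have hxx : ∀ i j : Fin N, Fin.castAdd N i < Fin.castAdd N j ↔ i < j := fun _ _ => Iff.rfl
  have hyy : ∀ i j : Fin N, Fin.natAdd N i < Fin.natAdd N j ↔ i < j := fun i j => by
    simp [← Fin.val_fin_lt]
  simp only [prod_Ioi_eq_prod_ite, Fin.prod_univ_add, Function.comp_apply,
    finSumFinEquiv_symm_apply_castAdd, finSumFinEquiv_symm_apply_natAdd, Sum.elim_inl, Sum.elim_inr,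
    Finset.prod_mul_distrib, hxy, hyx, hxx, hyy, if_true, if_false, Finset.prod_const_one]
  ring

lemma pairSum_pow_mul_pow (x y : Fin N → R) :
    pairSum (fun i a b => x i ^ colExp a * y i ^ colExp b) = (doubleVandermonde x y).det := by
  rw [← det_transpose, det_apply']
  simp [pairSum, pairTerm, doubleVandermonde, Fintype.prod_sum_type, Finset.prod_mul_distrib]

lemma sq_prod_Ioi_mul_prod_compl (x : Fin N → R) :
    (∏ i, ∏ j ∈ Finset.Ioi i, (x j - x i)) ^ 2 * ∏ i, ∏ j ∈ {i}ᶜ, (x j - x i)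
      = (∏ i : Fin N, ∏ _j ∈ Finset.Ioi i, -1) * ∏ i, ∏ j ∈ Finset.Ioi i, (x j - x i) ^ 4 := by
  rw [← Finset.prod_prod_Ioi_mul_eq_prod_prod_off_diag fun j i : Fin N => x j - x i]
  simp only [← Finset.prod_pow, ← Finset.prod_mul_distrib]
  exact Finset.prod_congr rfl fun i _ => Finset.prod_congr rfl fun j _ => by ring

/-- With `y = q x`, the antisymmetrised Vandermonde determinant is divisible by `(q - 1) ^ N`; the
confluent case is the value of the quotient at `q = 1`. -/
lemma pairSum_colExp_sub_mul_pow (x : Fin N → R) :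
    pairSum (fun i a b => x i ^ (colExp a + colExp b) * ((colExp b : R) - colExp a))
      = 2 ^ N * (∏ i, x i) * (∏ i, ∏ j ∈ Finset.Ioi i, (x j - x i)) ^ 2
        * ∏ i, ∏ j ∈ {i}ᶜ, (x j - x i) := by
  let g : ℕ → R[X] := fun n => ∑ i ∈ Finset.range n, X ^ i
  let A : R[X] := pairSum fun i a b =>
    C (x i) ^ (colExp a + colExp b) * (g (colExp b) - g (colExp a))
  let B : R[X] := 2 ^ N * (∏ i, C (x i)) * (∏ i, ∏ j ∈ Finset.Ioi i, (C (x j) - C (x i)))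
    * (∏ i, ∏ j ∈ Finset.Ioi i, (X * C (x j) - X * C (x i)))
    * ∏ i, ∏ j ∈ {i}ᶜ, (X * C (x j) - C (x i))
  have hAB : (X - 1) ^ N * A = (X - 1) ^ N * B := by
    have hA : (X - 1) ^ N * A = 2 ^ N * (doubleVandermonde (C ∘ x) fun i => X * C (x i)).det := by
      have hconst : ((X - 1) ^ N : R[X]) = ∏ _i : Fin N, (X - 1) := by simp
      have htwo := two_pow_mul_pairSum fun i a b => (C ∘ x) i ^ colExp a * (X * C (x i)) ^ colExp b
      rw [Fintype.card_fin, pairSum_pow_mul_pow] at htwo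
      rw [htwo, hconst, ← pairSum_mul_left]
      congr 1
      funext i a b
      rw [Function.comp_apply]
      linear_combination C (x i) ^ (colExp a + colExp b)
        * (mul_geom_sum (X : R[X]) (colExp b) - mul_geom_sum (X : R[X]) (colExp a))
    have hdiag : ∏ i, ∏ j, (X * C (x j) - (C ∘ x) i)
        = (X - 1) ^ N * ((∏ i, C (x i)) * ∏ i, ∏ j ∈ {i}ᶜ, (X * C (x j) - C (x i))) := by
      have hconst : ((X - 1) ^ N : R[X]) = ∏ _i : Fin N, (X - 1) := by simp
      rw [hconst, ← Finset.prod_mul_distrib, ← Finset.prod_mul_distrib]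
      refine Finset.prod_congr rfl fun i _ => ?_
      rw [Fintype.prod_eq_mul_prod_compl i, Function.comp_apply]
      ring
    rw [hA, det_doubleVandermonde, hdiag]
    simp only [B, Function.comp_apply]
    ring
  have hcancel : A = B := ((monic_X_sub_C (1 : R)).pow N).isRegular.left (by simpa using hAB)
  rw [sq]
  simpa [A, B, g, map_pairSum, eval_prod, eval_finsetSum, mul_assoc] using
    congrArg (evalRingHom (1 : R)) hcancel

end ConfluentVandermonde

section Density

variable {N : ℕ}

/-- The exponent of a column, doubled and centred; it takes the values
`-(2 N - 1), -(2 N - 3), …, 2 N - 1`. -/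
def freq (s : Fin N ⊕ Fin N) : ℂ := 2 * colExp s - (2 * N - 1)

lemma colExp_injective : Function.Injective (colExp : Fin N ⊕ Fin N → ℕ) :=
  Fin.val_injective.comp finSumFinEquiv.injective

lemma sum_colExp {M : Type*} [AddCommMonoid M] (f : ℕ → M) :
    ∑ s : Fin N ⊕ Fin N, f (colExp s) = ∑ e ∈ Finset.range (2 * N), f e := by
  rw [two_mul, ← Fin.sum_univ_eq_sum_range, ← finSumFinEquiv.sum_comp]
  rfl

lemma freq_injective : Function.Injective (freq : Fin N ⊕ Fin N → ℂ) := fun s t h => by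
  refine colExp_injective ?_
  unfold freq at h
  exact_mod_cast (by linear_combination h / 2 : (colExp s : ℂ) = colExp t)

lemma freq_ne_zero (s : Fin N ⊕ Fin N) : freq s ≠ 0 := fun h => by
  rw [freq] at h
  have hcast : (2 * colExp s + 1 : ℂ) = 2 * N := by linear_combination h
  have : 2 * colExp s + 1 = 2 * N := by exact_mod_cast hcast
  omega

lemma exists_freq_eq_neg (s : Fin N ⊕ Fin N) : ∃ t : Fin N ⊕ Fin N, freq t = -freq s := by
  refine ⟨finSumFinEquiv.symm (finSumFinEquiv s).rev, ?_⟩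
  have hrev : ((finSumFinEquiv s).rev : ℕ) + colExp s + 1 = N + N := by
    rw [Fin.val_rev, colExp]
    omega
  have hcast : ((finSumFinEquiv s).rev : ℂ) + colExp s + 1 = N + N := by exact_mod_cast hrev
  rw [freq, freq, colExp, Equiv.apply_symm_apply]
  linear_combination 2 * hcast

lemma pos_ne_zero (t : Config N) (j : Fin N) : pos t j ≠ 0 := Circle.coe_ne_zero _

lemma norm_pos (t : Config N) (j : Fin N) : ‖pos t j‖ = 1 := Circle.norm_coe _

lemma norm_pos_sub_rpow_four (t : Config N) (i j : Fin N) :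
    ((‖pos t i - pos t j‖ ^ (2 * (2 : ℝ)) : ℝ) : ℂ)
      = (pos t j - pos t i) ^ 4 * ((pos t i * pos t j) ^ 2)⁻¹ := by
  have hrpow : ‖pos t i - pos t j‖ ^ (2 * (2 : ℝ)) = (‖pos t i - pos t j‖ ^ 2) ^ 2 := by
    rw [← pow_mul, ← Real.rpow_natCast]
    norm_num
  have hconj : ∀ k, (starRingEnd ℂ) (pos t k) = (pos t k)⁻¹ := fun k =>
    (Complex.inv_eq_conj (norm_pos t k)).symm
  rw [hrpow, Complex.ofReal_pow, ← Complex.normSq_eq_norm_sq, ← Complex.mul_conj, map_sub, hconj,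
    hconj]
  have := pos_ne_zero t i
  have := pos_ne_zero t j
  field_simp
  ring

lemma prod_Ioi_mul {M : Type*} [CommMonoid M] (x : Fin N → M) :
    ∏ i, ∏ j ∈ Finset.Ioi i, (x i * x j) = ∏ i, x i ^ (N - 1) := by
  rw [Finset.prod_prod_Ioi_mul_eq_prod_prod_off_diag fun _ i => x i]
  simp [Finset.card_compl]

lemma density_two_eq (t : Config N) :
    (density N 2 t : ℂ) = (∏ i, ∏ j ∈ Finset.Ioi i, (pos t j - pos t i) ^ 4)
      * ∏ i, (pos t i * pos t i ^ (-(2 * N - 1 : ℤ))) := by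
  have hpair : ∏ i, ∏ j ∈ Finset.Ioi i, ((pos t i * pos t j) ^ 2)⁻¹
      = ∏ i, (pos t i * pos t i ^ (-(2 * N - 1 : ℤ))) := by
    simp only [Finset.prod_inv_distrib, Finset.prod_pow]
    rw [prod_Ioi_mul, ← Finset.prod_pow, ← Finset.prod_inv_distrib]
    refine Finset.prod_congr rfl fun i _ => ?_
    rw [← zpow_one_add₀ (pos_ne_zero t i), ← pow_mul, ← zpow_natCast, ← zpow_neg, Nat.cast_mul,
      Nat.cast_sub (Fin.pos i)]
    congr 1
    push_cast
    ring
  rw [density, ← hpair, Complex.ofReal_prod, ← Finset.prod_mul_distrib]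
  refine Finset.prod_congr rfl fun i _ => ?_
  rw [Complex.ofReal_prod, ← Finset.prod_mul_distrib]
  exact Finset.prod_congr rfl fun j _ => norm_pos_sub_rpow_four t i j

lemma exists_density_eq_pairSum (N : ℕ) : ∃ c : ℂ, ∀ t : Config N,
    (density N 2 t : ℂ) = c * pairSum fun i a b =>
      (freq b - freq a) * pos t i ^ ((colExp a + colExp b : ℤ) - (2 * N - 1)) := by
  refine ⟨((∏ i : Fin N, ∏ j ∈ Finset.Ioi i, -1) * 4 ^ N)⁻¹, fun t => ?_⟩
  have hfactor : (fun (i : Fin N) (a b : Fin N ⊕ Fin N) =>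
      (freq b - freq a) * pos t i ^ ((colExp a + colExp b : ℤ) - (2 * N - 1)))
      = fun i a b => 2 * pos t i ^ (-(2 * N - 1 : ℤ))
        * (pos t i ^ (colExp a + colExp b) * ((colExp b : ℂ) - colExp a)) := by
    funext i a b
    rw [sub_eq_add_neg (_ + _ : ℤ), zpow_add₀ (pos_ne_zero t i), ← Nat.cast_add, zpow_natCast,
      freq, freq]
    ring
  have hsign : (∏ i : Fin N, ∏ j ∈ Finset.Ioi i, (-1 : ℂ)) ≠ 0 := by
    simp [Finset.prod_ne_zero_iff]
  have hfour : (4 : ℂ) ^ N = 2 ^ N * 2 ^ N := by rw [← mul_pow]; norm_num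
  rw [hfactor, pairSum_mul_left, pairSum_colExp_sub_mul_pow, mul_assoc,
    sq_prod_Ioi_mul_prod_compl, density_two_eq, hfour]
  generalize ∏ i : Fin N, ∏ _j ∈ Finset.Ioi i, (-1 : ℂ) = ε at hsign ⊢
  rw [Finset.prod_mul_distrib, Finset.prod_mul_distrib, Finset.prod_const, Finset.card_univ,
    Fintype.card_fin]
  field_simp

end Density

section FourierCoefficients

variable {N : ℕ}

instance (N : ℕ) : IsProbabilityMeasure (refMeasure N) := by
  unfold refMeasure
  infer_instance

lemma continuous_pos (j : Fin N) : Continuous fun t : Config N => pos t j :=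
  continuous_subtype_val.comp (AddCircle.continuous_toCircle.comp (continuous_apply j))

lemma continuous_prod_zpow (m : Fin N → ℤ) : Continuous fun t : Config N => ∏ j, pos t j ^ m j :=
  continuous_finsetProd _ fun j _ => (continuous_pos j).zpow₀ _ fun t => .inl (pos_ne_zero t j)

lemma integrable_of_continuous {f : Config N → ℂ} (hf : Continuous f) :
    Integrable f (refMeasure N) :=
  hf.integrable_of_hasCompactSupport (HasCompactSupport.of_compactSpace f)

lemma integral_toCircle_zpow (n : ℤ) :
    ∫ t : UnitAddCircle, (AddCircle.toCircle t : ℂ) ^ n ∂AddCircle.haarAddCircle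
      = if n = 0 then 1 else 0 := by
  have hcoeff := congrFun (fourierCoeff_fourier (T := 1) n) 0
  simpa [fourierCoeff, fourier_apply, AddCircle.toCircle_zsmul, Pi.single_apply, eq_comm]
    using hcoeff

lemma integral_pairSum {φ : Fin N → Fin N ⊕ Fin N → Fin N ⊕ Fin N → UnitAddCircle → ℂ}
    (hφ : ∀ i a b, Continuous (φ i a b)) :
    ∫ t, pairSum (fun i a b => φ i a b (t i)) ∂refMeasure N
      = pairSum fun i a b => ∫ s, φ i a b s ∂AddCircle.haarAddCircle := by
  simp only [pairSum, pairTerm]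
  rw [integral_finsetSum]
  · refine Finset.sum_congr rfl fun σ _ => ?_
    rw [integral_const_mul, refMeasure, integral_fintype_prod_eq_prod]
  · exact fun σ _ => integrable_of_continuous <| continuous_const.mul <|
      continuous_finsetProd _ fun i _ => (hφ _ _ _).comp (continuous_apply i)

lemma exists_integral_prod_zpow_mul_density (N : ℕ) : ∃ c : ℂ, ∀ m : Fin N → ℤ,
    ∫ t, (∏ j, pos t j ^ m j) * (density N 2 t : ℂ) ∂refMeasure N
      = c * pairSum fun i => pairCoeff freq (-(2 * m i)) := by
  obtain ⟨c, hc⟩ := exists_density_eq_pairSum N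
  refine ⟨c, fun m => ?_⟩
  have hcoeff : ∀ i (a b : Fin N ⊕ Fin N),
      ∫ s : UnitAddCircle, (AddCircle.toCircle s : ℂ) ^ m i * ((freq b - freq a)
        * (AddCircle.toCircle s : ℂ) ^ ((colExp a + colExp b : ℤ) - (2 * N - 1)))
        ∂AddCircle.haarAddCircle = pairCoeff freq (-(2 * m i)) a b := by
    intro i a b
    have hfreq : m i + ((colExp a + colExp b : ℤ) - (2 * N - 1)) = 0
        ↔ freq a + freq b = -(2 * m i) := by
      rw [← Int.cast_eq_zero (α := ℂ), freq, freq]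
      push_cast
      constructor <;> intro h
      · linear_combination 2 * h
      · linear_combination h / 2
    simp only [mul_left_comm _ (freq b - freq a), ← zpow_add₀ (Circle.coe_ne_zero _),
      integral_const_mul, integral_toCircle_zpow, hfreq, pairCoeff, mul_ite, mul_one, mul_zero]
  have hcont : ∀ n : ℤ, Continuous fun s : UnitAddCircle => (AddCircle.toCircle s : ℂ) ^ n :=
    fun n => (continuous_subtype_val.comp AddCircle.continuous_toCircle).zpow₀ _ fun s =>
      .inl (Circle.coe_ne_zero _)
  simp only [hc, mul_left_comm _ c, ← pairSum_mul_left, integral_const_mul]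
  refine congrArg (c * ·) ((integral_pairSum fun i a b =>
    (hcont (m i)).mul (continuous_const.mul (hcont _))).trans ?_)
  exact congrArg pairSum (funext fun i => funext fun a => funext fun b => hcoeff i a b)

end FourierCoefficients

section Average

variable {N : ℕ} {κ : ℝ}

lemma continuous_density (hκ : 0 ≤ κ) : Continuous (density N κ) :=
  continuous_finsetProd _ fun i _ => continuous_finsetProd _ fun j _ =>
    ((continuous_pos i).sub (continuous_pos j)).norm.rpow_const fun _ => .inr (by positivity)

lemma density_nonneg (t : Config N) : 0 ≤ density N κ t :=
  Finset.prod_nonneg fun _ _ => Finset.prod_nonneg fun _ _ => by positivity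

lemma partitionFunction_pos (hκ : 0 ≤ κ) : 0 < partitionFunction N κ := by
  have : (refMeasure N).IsOpenPosMeasure := by
    unfold refMeasure
    infer_instance
  have : Infinite UnitAddCircle :=
    (AddCircle.equivIco (1 : ℝ) 0).infinite_iff.2 (Set.Ico_infinite (by norm_num)).to_subtype
  let e : Fin N ↪ UnitAddCircle := Fin.valEmbedding.trans (Infinite.natEmbedding UnitAddCircle)
  refine (continuous_density hκ).integral_pos_of_hasCompactSupport_nonneg_nonzero (x := e)
    (HasCompactSupport.of_compactSpace _) density_nonneg (ne_of_gt ?_)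
  refine Finset.prod_pos fun i _ => Finset.prod_pos fun j hj => Real.rpow_pos_of_pos ?_ _
  rw [norm_pos_iff, sub_ne_zero]
  intro h
  exact (Finset.mem_Ioi.1 hj).ne
    (e.injective (AddCircle.injective_toCircle one_ne_zero (Subtype.ext h)))

lemma integrable_mul_density (hκ : 0 ≤ κ) (f : C(Config N, ℂ)) :
    Integrable (fun t => f t * (density N κ t : ℂ)) (refMeasure N) :=
  integrable_of_continuous
    (f.continuous.mul (Complex.continuous_ofReal.comp (continuous_density hκ)))

lemma norm_average_le (hκ : 0 ≤ κ) (f : C(Config N, ℂ)) : ‖average N κ f‖ ≤ 1 * ‖f‖ := by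
  have hZ := partitionFunction_pos (N := N) hκ
  rw [average, norm_div, Complex.norm_real, Real.norm_of_nonneg hZ.le, div_le_iff₀ hZ, one_mul,
    partitionFunction, ← integral_const_mul]
  refine norm_integral_le_of_norm_le (.const_mul ?_ _) (.of_forall fun t => ?_)
  · exact (continuous_density hκ).integrable_of_hasCompactSupport
      (HasCompactSupport.of_compactSpace _)
  · rw [norm_mul, Complex.norm_real, Real.norm_of_nonneg (density_nonneg t)]
    exact mul_le_mul_of_nonneg_right (f.norm_coe_le_norm t) (density_nonneg t)

/-- The ensemble average as a continuous linear functional on the continuous statistics. -/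
def averageCLM (N : ℕ) (hκ : 0 ≤ κ) : C(Config N, ℂ) →L[ℂ] ℂ :=
  LinearMap.mkContinuous
    { toFun := fun f => average N κ f
      map_add' := fun f g => by
        simp only [average, ContinuousMap.add_apply, add_mul]
        rw [integral_add (integrable_mul_density hκ f) (integrable_mul_density hκ g), add_div]
      map_smul' := fun c f => by
        simp only [average, ContinuousMap.smul_apply, smul_eq_mul, mul_assoc, integral_const_mul,
          mul_div_assoc, RingHom.id_apply] }
    1 (norm_average_le hκ)

lemma averageCLM_apply (hκ : 0 ≤ κ) (f : C(Config N, ℂ)) : averageCLM N hκ f = average N κ f := rfl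

lemma averageCLM_one (hκ : 0 ≤ κ) : averageCLM N hκ 1 = 1 := by
  have hZ : (partitionFunction N κ : ℂ) ≠ 0 := by exact_mod_cast (partitionFunction_pos hκ).ne'
  simp only [averageCLM_apply, average, ContinuousMap.one_apply, one_mul]
  rw [integral_complex_ofReal]
  exact div_self hZ

/-- The second joint cumulant of two statistics. -/
def covariance (N : ℕ) (κ : ℝ) (f g : Config N → ℂ) : ℂ :=
  average N κ (fun t => f t * g t) - average N κ f * average N κ g

lemma covariance_smul_smul (hκ : 0 ≤ κ) (a b : ℂ) (f g : C(Config N, ℂ)) :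
    covariance N κ (a • f : C(Config N, ℂ)) (b • g : C(Config N, ℂ))
      = a * b * covariance N κ f g := by
  have havg : ∀ (c : ℂ) (f : C(Config N, ℂ)), average N κ (c • f : C(Config N, ℂ))
      = c * average N κ f := (averageCLM N hκ).map_smul
  have hmul : average N κ (fun t => (a • f : C(Config N, ℂ)) t * (b • g : C(Config N, ℂ)) t)
      = average N κ ((a * b) • (f * g) : C(Config N, ℂ)) := by
    congr 1
    funext t
    simp only [ContinuousMap.smul_apply, ContinuousMap.mul_apply, smul_eq_mul]
    ring
  rw [covariance, hmul, havg, havg, havg, covariance, ContinuousMap.coe_mul, Pi.mul_def]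
  ring

lemma hasSum_covariance (hκ : 0 ≤ κ) {F G : ℕ → C(Config N, ℂ)} {f g : Config N → ℂ}
    (hF : Summable fun k => ‖F k‖) (hG : Summable fun k => ‖G k‖)
    (hf : ∀ t, HasSum (fun k => F k t) (f t)) (hg : ∀ t, HasSum (fun k => G k t) (g t)) :
    HasSum (fun p : ℕ × ℕ => covariance N κ (F p.1) (G p.2)) (covariance N κ f g) := by
  obtain rfl : f = ⇑(∑' k, F k) := funext fun t =>
    (hf t).unique (ContinuousMap.hasSum_apply hF.of_norm.hasSum t)
  obtain rfl : g = ⇑(∑' k, G k) := funext fun t =>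
    (hg t).unique (ContinuousMap.hasSum_apply hG.of_norm.hasSum t)
  have hFavg := (averageCLM N hκ).summable hF.of_norm
  have hGavg := (averageCLM N hκ).summable hG.of_norm
  have hjoint := (summable_mul_of_summable_norm hF hG).hasSum.mapL (averageCLM N hκ)
  have hsep := (summable_mul_of_summable_norm hFavg.norm hGavg.norm).hasSum
  rw [← tsum_mul_tsum_of_summable_norm hF hG] at hjoint
  rw [← tsum_mul_tsum_of_summable_norm hFavg.norm hGavg.norm,
    ← (averageCLM N hκ).map_tsum hF.of_norm, ← (averageCLM N hκ).map_tsum hG.of_norm] at hsep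
  exact hjoint.sub hsep

end Average

section RotationInvariance

variable {N : ℕ}

lemma pos_add_const (t : Config N) (s : UnitAddCircle) (j : Fin N) :
    pos (t + fun _ => s) j = AddCircle.toCircle s * pos t j := by
  rw [pos, pos, Pi.add_apply, AddCircle.toCircle_add, Circle.coe_mul, mul_comm]

lemma density_add_const (κ : ℝ) (t : Config N) (s : UnitAddCircle) :
    density N κ (t + fun _ => s) = density N κ t := by
  simp only [density, pos_add_const, ← mul_sub, norm_mul, Circle.norm_coe, one_mul]

lemma average_comp_add_const (κ : ℝ) (f : Config N → ℂ) (s : UnitAddCircle) :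
    average N κ (fun t => f (t + fun _ => s)) = average N κ f := by
  have hinv : (refMeasure N).IsAddRightInvariant := by
    unfold refMeasure
    infer_instance
  rw [average, average,
    ← integral_add_right_eq_self (fun t => f t * (density N κ t : ℂ)) fun _ => s]
  simp only [density_add_const]

lemma exists_toCircle_zpow_ne_one {n : ℤ} (hn : n ≠ 0) :
    ∃ s : UnitAddCircle, (AddCircle.toCircle s : ℂ) ^ n ≠ 1 := by
  by_contra! h
  simpa [h, hn] using integral_toCircle_zpow n

lemma average_eq_zero_of_rotate {n : ℤ} (hn : n ≠ 0) (κ : ℝ) {f : Config N → ℂ}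
    (hf : ∀ s t, f (t + fun _ => s) = (AddCircle.toCircle s : ℂ) ^ n * f t) :
    average N κ f = 0 := by
  obtain ⟨s, hs⟩ := exists_toCircle_zpow_ne_one hn
  have hrot := average_comp_add_const κ f s
  simp only [average, hf, mul_assoc, integral_const_mul, mul_div_assoc] at hrot
  by_contra hf0
  exact hs ((mul_eq_right₀ hf0).1 hrot)

/-- The power sum `∑ⱼ ζⱼ ^ n`. -/
def powerSum (n : ℤ) : C(Config N, ℂ) where
  toFun t := ∑ j, pos t j ^ n
  continuous_toFun := continuous_finsetSum _ fun j _ =>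
    (continuous_pos j).zpow₀ _ fun t => .inl (pos_ne_zero t j)

lemma powerSum_apply (n : ℤ) (t : Config N) : powerSum n t = ∑ j, pos t j ^ n := rfl

lemma powerSum_zero : (powerSum 0 : C(Config N, ℂ)) = (N : ℂ) • 1 := by
  ext t
  simp [powerSum_apply]

lemma powerSum_add_const (n : ℤ) (s : UnitAddCircle) (t : Config N) :
    powerSum n (t + fun _ => s) = (AddCircle.toCircle s : ℂ) ^ n * powerSum n t := by
  simp only [powerSum_apply, pos_add_const, mul_zpow, Finset.mul_sum]

lemma average_powerSum {n : ℤ} (hn : n ≠ 0) (κ : ℝ) :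
    average N κ (powerSum n) = 0 :=
  average_eq_zero_of_rotate hn κ (powerSum_add_const n)

lemma covariance_powerSum_of_add_ne_zero {m n : ℤ} (hmn : m + n ≠ 0) (κ : ℝ) :
    covariance N κ (powerSum m) (powerSum n) = 0 := by
  have hjoint : average N κ (fun t => powerSum m t * powerSum n t) = 0 :=
    average_eq_zero_of_rotate hmn κ fun s t => by
      rw [powerSum_add_const, powerSum_add_const, zpow_add₀ (Circle.coe_ne_zero _)]
      ring
  have hsep : average N κ (powerSum (N := N) m) * average N κ (powerSum (N := N) n) = 0 := by
    rcases eq_or_ne m 0 with rfl | hm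
    · rw [average_powerSum (n := n) (by rwa [zero_add] at hmn), mul_zero]
    · rw [average_powerSum hm, zero_mul]
  rw [covariance, hjoint, hsep, sub_zero]

/-- The structure factor `⟨|∑ⱼ ζⱼ ^ k|²⟩ - |⟨∑ⱼ ζⱼ ^ k⟩|²`. -/
def structureFactor (N : ℕ) (κ : ℝ) (k : ℕ) : ℂ :=
  covariance N κ (powerSum (-k)) (powerSum k)

lemma structureFactor_zero {κ : ℝ} (hκ : 0 ≤ κ) : structureFactor N κ 0 = 0 := by
  have hone : covariance N κ (1 : C(Config N, ℂ)) (1 : C(Config N, ℂ)) = 0 := by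
    have h : average N κ (fun _ => 1) = 1 := averageCLM_one hκ
    simp [covariance, ContinuousMap.coe_one, Pi.one_def, h]
  rw [structureFactor, Nat.cast_zero, neg_zero, powerSum_zero, covariance_smul_smul hκ, hone,
    mul_zero]

end RotationInvariance

section Resolvent

variable {N : ℕ}

lemma one_sub_ne_zero {w : ℂ} (hw : ‖w‖ < 1) : 1 - w ≠ 0 :=
  sub_ne_zero.2 fun h => by simp [← h] at hw

/-- The Taylor coefficients of `(1 + w) / (1 - w)`. -/
def herglotzCoeff (k : ℕ) : ℂ := if k = 0 then 1 else 2

lemma norm_herglotzCoeff_le (k : ℕ) : ‖herglotzCoeff k‖ ≤ 2 := by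
  unfold herglotzCoeff
  split_ifs <;> norm_num

lemma hasSum_herglotzCoeff {w : ℂ} (hw : ‖w‖ < 1) :
    HasSum (fun k => herglotzCoeff k * w ^ k) ((1 + w) / (1 - w)) := by
  have hgeom := ((hasSum_geometric_of_norm_lt_one hw).mul_left 2).sub (hasSum_ite_eq 0 (1 : ℂ))
  have hvalue : (1 + w) / (1 - w) = 2 * (1 - w)⁻¹ - 1 := by
    have := one_sub_ne_zero hw
    field_simp
    ring
  rw [hvalue]
  refine hgeom.congr_fun fun k => ?_
  rcases eq_or_ne k 0 with rfl | hk
  · norm_num [herglotzCoeff]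
  · simp [herglotzCoeff, hk]

lemma hasSum_herglotzSum_inner {z : ℂ} (hz : ‖z‖ < 1) (t : Config N) :
    HasSum (fun k : ℕ => ((herglotzCoeff k * z ^ k) • powerSum (-k)) t) (herglotzSum z t) := by
  simp only [ContinuousMap.smul_apply, powerSum_apply, smul_eq_mul, Finset.mul_sum]
  refine hasSum_sum fun j _ => ?_
  have hpos := pos_ne_zero t j
  have hvalue : (pos t j + z) / (pos t j - z) = (1 + z / pos t j) / (1 - z / pos t j) := by
    field_simp
  rw [hvalue]
  refine (hasSum_herglotzCoeff (w := z / pos t j) (by simpa [norm_pos] using hz)).congr_fun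
    fun k => ?_
  rw [div_pow, zpow_neg, zpow_natCast, mul_assoc, div_eq_mul_inv]

lemma hasSum_herglotzSum_outer {z : ℂ} (hz : 1 < ‖z‖) (t : Config N) :
    HasSum (fun k : ℕ => ((-(herglotzCoeff k * z⁻¹ ^ k)) • powerSum k) t) (herglotzSum z t) := by
  simp only [ContinuousMap.smul_apply, powerSum_apply, smul_eq_mul, Finset.mul_sum]
  refine hasSum_sum fun j _ => ?_
  have hz0 : z ≠ 0 := norm_pos_iff.1 (zero_lt_one.trans hz)
  have hvalue : (pos t j + z) / (pos t j - z) = -((1 + pos t j / z) / (1 - pos t j / z)) := by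
    have hden : -(1 - pos t j / z) = (pos t j - z) / z := by
      field_simp
      ring
    rw [← div_neg, hden]
    field_simp
    ring
  rw [hvalue]
  refine (hasSum_herglotzCoeff (w := pos t j / z)
    (by simpa [norm_pos] using inv_lt_one_of_one_lt₀ hz)).neg.congr_fun fun k => ?_
  rw [div_pow, zpow_natCast, inv_pow]
  ring

lemma norm_powerSum_le (n : ℤ) : ‖(powerSum n : C(Config N, ℂ))‖ ≤ N := by
  refine (ContinuousMap.norm_le _ N.cast_nonneg).2 fun t => ?_
  rw [powerSum_apply]
  refine (norm_sum_le _ _).trans ?_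
  simp [norm_zpow, norm_pos]

lemma summable_norm_smul_powerSum {w : ℂ} (hw : ‖w‖ < 1) (n : ℕ → ℤ) :
    Summable fun k => ‖(herglotzCoeff k * w ^ k) • (powerSum (n k) : C(Config N, ℂ))‖ := by
  refine .of_nonneg_of_le (fun _ => norm_nonneg _) (fun k => ?_)
    ((summable_geometric_of_lt_one (norm_nonneg w) hw).mul_left (2 * N : ℝ))
  rw [norm_smul, norm_mul, norm_pow]
  calc ‖herglotzCoeff k‖ * ‖w‖ ^ k * ‖powerSum (n k)‖ ≤ 2 * ‖w‖ ^ k * N := by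
        gcongr
        exacts [norm_herglotzCoeff_le k, norm_powerSum_le _]
    _ = 2 * N * ‖w‖ ^ k := by ring

theorem hasSum_W₂ {κ : ℝ} (hκ : 0 ≤ κ) {z₁ z₂ : ℂ} (hz₁ : ‖z₁‖ < 1) (hz₂ : 1 < ‖z₂‖) :
    HasSum (fun k => -4 * (structureFactor N κ k * (z₁ / z₂) ^ k)) (W₂ N κ z₁ z₂) := by
  have hz₂' : ‖z₂⁻¹‖ < 1 := by simpa using inv_lt_one_of_one_lt₀ hz₂
  have hinner := summable_norm_smul_powerSum (N := N) hz₁ fun k => -k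
  have houter : Summable fun k : ℕ =>
      ‖(-(herglotzCoeff k * z₂⁻¹ ^ k)) • (powerSum k : C(Config N, ℂ))‖ := by
    simpa only [norm_smul, norm_neg] using summable_norm_smul_powerSum (N := N) hz₂' fun k => k
  have hsum := hasSum_covariance hκ hinner houter
    (hasSum_herglotzSum_inner hz₁) (hasSum_herglotzSum_outer hz₂)
  simp only [covariance_smul_smul hκ] at hsum
  have hdiag : Function.Injective fun k : ℕ => (k, k) := fun a b hab => (Prod.mk.inj hab).1
  rw [← hdiag.hasSum_iff] at hsum
  · refine hsum.congr_fun fun k => ?_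
    rw [Function.comp_apply, ← structureFactor]
    rcases eq_or_ne k 0 with rfl | hk
    · simp only [structureFactor_zero hκ, mul_zero, zero_mul]
    · simp only [herglotzCoeff, hk, if_false, div_eq_mul_inv, mul_pow]
      ring
  · rintro ⟨j, k⟩ hjk
    have hne : -(j : ℤ) + k ≠ 0 := fun h => hjk ⟨j, Prod.ext rfl (by dsimp only; omega)⟩
    rw [covariance_powerSum_of_add_ne_zero hne, mul_zero]

end Resolvent

section SymplecticStructureFactor

open Finset

variable {N : ℕ}

lemma average_prod_zpow (m : Fin N → ℤ) :
    average N 2 (fun t => ∏ j, pos t j ^ m j)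
      = (pairSum fun i => pairCoeff freq (-(2 * m i)))
        / pairSum fun _ : Fin N => pairCoeff freq 0 := by
  obtain ⟨c, hc⟩ := exists_integral_prod_zpow_mul_density N
  have hZ : (partitionFunction N 2 : ℂ) = c * pairSum fun _ : Fin N => pairCoeff freq 0 := by
    simpa [partitionFunction, integral_complex_ofReal] using hc 0
  have hZ0 : (partitionFunction N 2 : ℂ) ≠ 0 := by
    exact_mod_cast (partitionFunction_pos zero_le_two).ne'
  rw [average, hc, hZ, mul_div_mul_left _ _ (left_ne_zero_of_mul (hZ ▸ hZ0))]

lemma pairSum_freq_zero_ne_zero : (pairSum fun _ : Fin N => pairCoeff freq 0) ≠ 0 := by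
  intro h
  have hone : average N 2 (fun _ => 1) = 1 := averageCLM_one zero_le_two
  simpa [h, hone] using average_prod_zpow (0 : Fin N → ℤ)

lemma prod_zpow_transfer (k : ℤ) (t : Config N) (j l : Fin N) :
    ∏ i, pos t i ^ transfer k j l i = pos t j ^ (-k) * pos t l ^ k := by
  have hsingle : ∀ (j : Fin N) (m : ℤ), ∏ i, pos t i ^ (Pi.single j m : Fin N → ℤ) i
      = pos t j ^ m := fun j m => by
    rw [Fintype.prod_eq_single j fun i hi => by simp [hi], Pi.single_eq_same]
  simp only [Pi.add_apply, zpow_add₀ (pos_ne_zero t _), prod_mul_distrib, hsingle]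

lemma average_powerSum_mul_powerSum_neg {k : ℤ} (hk : k ≠ 0) :
    average N 2 (fun t => powerSum k t * powerSum (-k) t)
      = N + (∑ s : Fin N ⊕ Fin N, ∑ t : Fin N ⊕ Fin N,
          exchangeWeight (2 * k : ℂ) (freq s) (freq t)) / 4 := by
  let F : Fin N → Fin N → C(Config N, ℂ) := fun j l =>
    ⟨fun t => ∏ i, pos t i ^ transfer (-k) j l i, continuous_prod_zpow _⟩
  have hF : (fun t : Config N => powerSum k t * powerSum (-k) t) = ⇑(∑ j, ∑ l, F j l) := by
    funext t
    simp only [powerSum_apply, sum_mul_sum, ContinuousMap.sum_apply, F, ContinuousMap.coe_mk,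
      prod_zpow_transfer, neg_neg]
  have hcoeff : ∀ j l i : Fin N, -(2 * ((transfer (-k) j l i : ℤ) : ℂ))
      = transfer (2 * k : ℂ) j l i := fun j l i => by
    simp only [Pi.add_apply, Pi.single_apply]
    split_ifs <;> push_cast <;> ring
  have htransfer := sum_pairSum_transfer (k := (2 * k : ℂ)) (freq_injective (N := N))
    exists_freq_eq_neg freq_ne_zero (by simpa using hk)
  rw [hF, ← averageCLM_apply zero_le_two]
  simp only [map_sum, averageCLM_apply]
  simp only [F, ContinuousMap.coe_mk, average_prod_zpow, hcoeff, ← sum_div, htransfer,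
    Fintype.card_fin]
  exact mul_div_cancel_right₀ _ pairSum_freq_zero_ne_zero

lemma sum_exchangeWeight {ι : Type*} [Fintype ι] {d : ι → ℂ} (h0 : ∀ s, d s ≠ 0) (k : ℂ) :
    ∑ s, ∑ t, exchangeWeight k (d s) (d t)
      = ∑ s, ∑ t, if d s + d t = k then k / d s - 2 else 0 := by
  have hsplit : ∀ s t, exchangeWeight k (d s) (d t)
      = ((if d s + d t = k then k / d s - 2 else 0)
        + if d t + d s = k then k / d t - 2 else 0) / 2 := by
    intro s t
    have hs := h0 s
    have ht := h0 t
    rw [exchangeWeight, add_comm (d t)]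
    split_ifs with hk
    · rw [← hk]
      field_simp
      ring
    · norm_num
  simp only [hsplit, ← sum_div, sum_add_distrib]
  rw [sum_comm (f := fun s t => if d t + d s = k then k / d t - 2 else 0)]
  ring

/-- The reciprocal odd integer `1 / (2 N - 1 - 2 e)`, which is `-(freq s)⁻¹` at `e = colExp s`. -/
def oddInv (N e : ℕ) : ℂ := (2 * N - 1 - 2 * e)⁻¹

/-- The partial sums of `oddInv`, which enter the structure factor as harmonic numbers would. -/
def oddHarmonic (N k : ℕ) : ℂ := ∑ e ∈ range k, oddInv N e

lemma odd_ne_zero (N e : ℕ) : (2 * N - 1 - 2 * e : ℂ) ≠ 0 := by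
  have : (2 * N - 1 - 2 * e : ℤ) ≠ 0 := by omega
  exact_mod_cast this

lemma oddHarmonic_two_mul (N : ℕ) : oddHarmonic N (2 * N) = 0 := by
  refine CharZero.eq_neg_self_iff.1 ?_
  rw [oddHarmonic, ← sum_neg_distrib, ← sum_range_reflect]
  refine sum_congr rfl fun e he => ?_
  have := mem_range.1 he
  rw [oddInv, oddInv, ← inv_neg, Nat.cast_sub (by omega), Nat.cast_sub (by omega)]
  congr 1
  push_cast
  ring

lemma sum_range_ite_le {M : Type*} [AddCommGroup M] (f : ℕ → M) (k n : ℕ) :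
    (∑ e ∈ range n, if k ≤ e then f e else 0)
      = ∑ e ∈ range n, f e - ∑ e ∈ range (min k n), f e := by
  have hnot : (range n).filter (¬ k ≤ ·) = range (min k n) := by
    ext e
    simp [and_comm]
  rw [← sum_filter, ← sum_filter_add_sum_filter_not (range n) (k ≤ ·) f, hnot, add_sub_cancel_right]

lemma sum_sum_exchangeWeight_freq (k : ℕ) :
    ∑ s : Fin N ⊕ Fin N, ∑ t : Fin N ⊕ Fin N, exchangeWeight (2 * k : ℂ) (freq s) (freq t)
      = ∑ e ∈ range (2 * N), if k ≤ e then -(2 * k * oddInv N e) - 2 else 0 := by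
  rw [sum_exchangeWeight freq_ne_zero, ← sum_colExp]
  refine sum_congr rfl fun s _ => ?_
  have hs : colExp s < N + N := Fin.is_lt _
  have hfreq : ∀ t : Fin N ⊕ Fin N,
      freq s + freq t = 2 * k ↔ colExp s + colExp t + 1 = k + 2 * N := fun t => by
    rw [← Nat.cast_inj (R := ℂ), freq, freq]
    push_cast
    constructor <;> intro h
    · linear_combination h / 2
    · linear_combination 2 * h
  have hterm : 2 * (k : ℂ) / freq s - 2 = -(2 * k * oddInv N (colExp s)) - 2 := by
    have hneg : freq s = -(2 * N - 1 - 2 * colExp s) := by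
      rw [freq]
      ring
    rw [hneg, oddInv, div_neg, div_eq_mul_inv]
  simp only [hfreq, hterm]
  rw [sum_colExp fun e => if colExp s + e + 1 = k + 2 * N then
    -(2 * k * oddInv N (colExp s)) - 2 else 0]
  split_ifs with hk
  · rw [sum_eq_single_of_mem (k + 2 * N - 1 - colExp s) (mem_range.2 (by omega)) fun e _ he =>
      if_neg (by omega), if_pos (by omega)]
  · exact sum_eq_zero fun e he => if_neg (by have := mem_range.1 he; omega)

theorem structureFactor_two (N k : ℕ) :
    structureFactor N 2 k
      = ((min k (2 * N) : ℕ) + k * oddHarmonic N (min k (2 * N))) / 2 := by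
  rcases eq_or_ne k 0 with rfl | hk
  · rw [structureFactor_zero zero_le_two]
    simp
  have hk' : (k : ℤ) ≠ 0 := by exact_mod_cast hk
  have hmoment := average_powerSum_mul_powerSum_neg (N := N) hk'
  simp only [mul_comm (powerSum (k : ℤ) _), Int.cast_natCast] at hmoment
  rw [structureFactor, covariance, average_powerSum hk', mul_zero, sub_zero, hmoment,
    sum_sum_exchangeWeight_freq, sum_range_ite_le]
  have hzero : ∑ e ∈ range (2 * N), oddInv N e = 0 := oddHarmonic_two_mul N
  simp only [sum_sub_distrib, sum_neg_distrib, ← mul_sum, hzero, sum_const, card_range,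
    nsmul_eq_mul, oddHarmonic]
  push_cast
  ring

end SymplecticStructureFactor

section RationalSeries

open Polynomial

/-- `HasRationalSeries a Q n`: on the open unit disc the power series with coefficients `a`
converges to the rational function `Q / (1 - X) ^ n`. -/
def HasRationalSeries (a : ℕ → ℂ) (Q : ℂ[X]) (n : ℕ) : Prop :=
  ∀ ζ : ℂ, ‖ζ‖ < 1 → HasSum (fun k => a k * ζ ^ k) (Q.eval ζ / (1 - ζ) ^ n)

lemma hasRationalSeries_truncation (a : ℕ → ℂ) (n : ℕ) :
    HasRationalSeries (fun k => if k < n then a k else 0)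
      (∑ k ∈ Finset.range n, C (a k) * X ^ k) 0 := fun ζ _ => by
  simpa [eval_finsetSum, Finset.sum_ite, ← Finset.mem_range, Finset.sum_congr] using
    hasSum_sum_of_ne_finset_zero (f := fun k => (if k < n then a k else 0) * ζ ^ k)
      (s := Finset.range n) fun k hk => by simp_all

lemma deriv_eval_div_one_sub_pow (Q : ℂ[X]) (n : ℕ) {ζ : ℂ} (hζ : 1 - ζ ≠ 0) :
    deriv (fun w => Q.eval w / (1 - w) ^ n) ζ
      = ((1 - X) * derivative Q + (n : ℂ[X]) * Q).eval ζ / (1 - ζ) ^ (n + 1) := by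
  have hpow := ((hasDerivAt_id ζ).const_sub 1).fun_pow n
  simp only [id] at hpow
  rw [((Q.hasDerivAt ζ).fun_div hpow (pow_ne_zero n hζ)).deriv]
  rcases n with _ | n
  · simp only [pow_zero, mul_one, Nat.cast_zero, mul_neg, mul_zero, neg_zero, zero_mul, sub_zero,
      one_pow, div_one, add_zero, eval_mul, eval_sub, eval_one, eval_X, zero_add, pow_one]
    field_simp
  · simp only [Nat.add_sub_cancel, mul_neg, mul_one, sub_neg_eq_add, eval_add, eval_mul, eval_sub,
      eval_one, eval_X, eval_natCast]
    field_simp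
    ring

namespace HasRationalSeries

variable {a : ℕ → ℂ} {Q : ℂ[X]} {n : ℕ}

/-- The partial sums are the coefficients of the product with the geometric series, shifted. -/
lemma sum_range (h : HasRationalSeries a Q n) :
    HasRationalSeries (fun k => ∑ e ∈ Finset.range k, a e) (X * Q) (n + 1) := fun ζ hζ => by
  have hgeom := hasSum_geometric_of_norm_lt_one hζ
  have hprod := hasSum_sum_range_mul_of_summable_norm (h ζ hζ).summable.norm hgeom.summable.norm
  rw [(h ζ hζ).tsum_eq, hgeom.tsum_eq] at hprod
  have hvalue : (X * Q).eval ζ / (1 - ζ) ^ (n + 1)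
      = ζ * (Q.eval ζ / (1 - ζ) ^ n * (1 - ζ)⁻¹) := by
    rw [eval_mul, eval_X, pow_succ, mul_div_assoc, div_mul_eq_div_div, div_eq_mul_inv _ (1 - ζ)]
  rw [hvalue, ← hasSum_nat_add_iff' 1]
  simp only [Finset.sum_range_one, Finset.sum_range_zero, zero_mul, sub_zero]
  refine (hprod.mul_left ζ).congr_fun fun k => ?_
  rw [Finset.sum_mul, Finset.mul_sum]
  refine Finset.sum_congr rfl fun e he => ?_
  have hk : k + 1 = 1 + e + (k - e) := by
    have := Finset.mem_range.1 he
    omega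
  rw [hk, pow_add, pow_add]
  ring

lemma natCast_mul (h : HasRationalSeries a Q n) :
    HasRationalSeries (fun k => k * a k)
      (X * ((1 - X) * derivative Q + (n : ℂ[X]) * Q)) (n + 1) := fun ζ hζ => by
  obtain ⟨r, hζr, hr⟩ := exists_between hζ
  have hr0 : 0 ≤ r := (norm_nonneg ζ).trans hζr.le
  have hdisc : ∀ w ∈ Metric.ball (0 : ℂ) r, ‖w‖ < r := fun w => mem_ball_zero_iff.1
  have hmem : ζ ∈ Metric.ball (0 : ℂ) r := mem_ball_zero_iff.2 hζr
  have hbound : Summable fun k => ‖a k‖ * r ^ k := by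
    have hsum := (h r (by rwa [Complex.norm_real, Real.norm_of_nonneg hr0])).summable.norm
    simpa [abs_of_nonneg hr0] using hsum
  have hseries := Complex.hasSum_deriv_of_summable_norm hbound (F := fun k w => a k * w ^ k)
    (fun k => by fun_prop) Metric.isOpen_ball (fun k w hw => by
      rw [norm_mul, norm_pow]
      gcongr
      exact (hdisc w hw).le) hmem
  have hfun : (fun w => ∑' k, a k * w ^ k) =ᶠ[nhds ζ] fun w => Q.eval w / (1 - w) ^ n := by
    filter_upwards [Metric.isOpen_ball.mem_nhds hmem] with w hw
    exact (h w ((hdisc w hw).trans hr)).tsum_eq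
  rw [hfun.deriv_eq, deriv_eval_div_one_sub_pow Q n (one_sub_ne_zero hζ)] at hseries
  rw [eval_mul, eval_X, mul_div_assoc]
  refine (hseries.mul_left ζ).congr_fun fun k => ?_
  rw [deriv_const_mul_field, deriv_pow_field]
  rcases k with _ | k
  · simp
  · rw [Nat.add_sub_cancel, pow_succ]
    ring

end HasRationalSeries
end RationalSeries

section ClosedForm

open Finset Polynomial

variable {N : ℕ} {ζ : ℂ}

/-- The generating polynomial of the reciprocals `oddInv N e` with `e < 2 N`. -/
def oddInvPoly (N : ℕ) : ℂ[X] := ∑ e ∈ range (2 * N), C (oddInv N e) * X ^ e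

lemma sum_range_min {M : Type*} [AddCommMonoid M] (f : ℕ → M) (k n : ℕ) :
    ∑ e ∈ range (min k n), f e = ∑ e ∈ range k, if e < n then f e else 0 := by
  rw [← sum_filter]
  congr 1
  ext e
  simp

lemma eval_oddInvPoly (N : ℕ) (ζ : ℂ) :
    (oddInvPoly N).eval ζ = ∑ e ∈ range (2 * N), oddInv N e * ζ ^ e := by
  simp [oddInvPoly, eval_finsetSum]

lemma two_mul_eval_derivative_oddInvPoly (N : ℕ) (ζ : ℂ) :
    2 * ζ * (derivative (oddInvPoly N)).eval ζ
      = (2 * N - 1) * (oddInvPoly N).eval ζ - ∑ e ∈ range (2 * N), ζ ^ e := by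
  rw [eval_oddInvPoly, oddInvPoly, derivative_sum, eval_finsetSum, mul_sum, mul_sum,
    ← sum_sub_distrib]
  refine sum_congr rfl fun e _ => ?_
  have hodd : (2 * N - 1 - 2 * e) * oddInv N e = 1 := mul_inv_cancel₀ (odd_ne_zero N e)
  have hpow : ζ * (e * ζ ^ (e - 1)) = e * ζ ^ e := by
    rcases e with _ | e
    · simp
    · rw [Nat.add_sub_cancel, pow_succ]
      ring
  rw [derivative_C_mul_X_pow, eval_C_mul, eval_pow, eval_X]
  linear_combination 2 * oddInv N e * hpow - ζ ^ e * hodd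

lemma hasSum_structureFactor_two (N : ℕ) (hζ : ‖ζ‖ < 1) :
    HasSum (fun k => -4 * (structureFactor N 2 k * ζ ^ k))
      (-(ζ * (oddInvPoly N).eval ζ) * (2 * ζ / (1 - ζ) ^ 2 + (2 * N + 1) / (1 - ζ))
        - ζ * (∑ e ∈ range (2 * N), ζ ^ e) / (1 - ζ)) := by
  have hne := one_sub_ne_zero hζ
  have hmin := (hasRationalSeries_truncation 1 (2 * N)).sum_range ζ hζ
  have hharmonic := (hasRationalSeries_truncation (oddInv N) (2 * N)).sum_range.natCast_mul ζ hζ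
  have hderiv := two_mul_eval_derivative_oddInvPoly N ζ
  rw [← oddInvPoly] at hharmonic
  simp only [← sum_range_min] at hmin hharmonic
  have hsum := ((hmin.add hharmonic).mul_left (-2)).congr_fun
    (g := fun k => -4 * (structureFactor N 2 k * ζ ^ k)) fun k => by
      simp only [structureFactor_two, oddHarmonic, Pi.one_apply, sum_const, card_range,
        nsmul_eq_mul, mul_one]
      ring
  have hvalue : -2 * ((X * ∑ e ∈ range (2 * N), C ((1 : ℕ → ℂ) e) * X ^ e).eval ζ
          / (1 - ζ) ^ (0 + 1)
        + (X * ((1 - X) * derivative (X * oddInvPoly N)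
          + ((0 + 1 : ℕ) : ℂ[X]) * (X * oddInvPoly N))).eval ζ / (1 - ζ) ^ (0 + 1 + 1))
      = -(ζ * (oddInvPoly N).eval ζ) * (2 * ζ / (1 - ζ) ^ 2 + (2 * N + 1) / (1 - ζ))
        - ζ * (∑ e ∈ range (2 * N), ζ ^ e) / (1 - ζ) := by
    simp only [Pi.one_apply, map_one, one_mul, eval_mul, eval_X, eval_finsetSum, eval_pow, zero_add,
      pow_one, derivative_mul, derivative_X, Nat.cast_one, Nat.reduceAdd, eval_add, eval_sub,
      eval_one]
    field_simp
    linear_combination -ζ * (1 - ζ) * hderiv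
  rwa [hvalue] at hsum

lemma ascPochhammer_eval_mul_add_natCast (b : ℂ) (n : ℕ) :
    (ascPochhammer ℂ n).eval b * (b + n) = b * (ascPochhammer ℂ n).eval (b + 1) := by
  rw [← ascPochhammer_succ_eval, ascPochhammer_succ_left]
  simp

lemma ordinaryHypergeometric_one_add_one {b : ℂ} (hb : ∀ n : ℕ, b + n ≠ 0) (x : ℂ) :
    ₂F₁ (1 : ℂ) b (b + 1) x = ∑' n : ℕ, b / (b + n) * x ^ n := by
  rw [ordinaryHypergeometric_eq_tsum]
  refine tsum_congr fun n => ?_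
  have hasc := ascPochhammer_eval_mul_add_natCast b n
  have hasc_ne : (ascPochhammer ℂ n).eval (b + 1) ≠ 0 := by
    rw [Ne, ascPochhammer_eval_eq_zero_iff]
    rintro ⟨k, -, hk⟩
    exact hb (k + 1) (by push_cast; linear_combination hk)
  have hbn := hb n
  have hfact : (n.factorial : ℂ) ≠ 0 := by exact_mod_cast n.factorial_ne_zero
  rw [ascPochhammer_eval_one, smul_eq_mul]
  field_simp
  linear_combination x ^ n * hasc

lemma norm_oddInv_le_one (N e : ℕ) : ‖oddInv N e‖ ≤ 1 := by
  have hint : (2 * N - 1 - 2 * e : ℂ) = (2 * N - 1 - 2 * e : ℤ) := by push_cast; ring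
  rw [oddInv, norm_inv, hint, Complex.norm_intCast]
  refine inv_le_one_of_one_le₀ ?_
  exact_mod_cast Int.one_le_abs (by omega : (2 * N - 1 - 2 * e : ℤ) ≠ 0)

lemma summable_oddInv_mul_pow (N : ℕ) (hζ : ‖ζ‖ < 1) : Summable fun e => oddInv N e * ζ ^ e := by
  refine .of_norm_bounded (summable_geometric_of_lt_one (norm_nonneg _) hζ) fun e => ?_
  rw [norm_mul, norm_pow]
  exact mul_le_of_le_one_left (by positivity) (norm_oddInv_le_one N e)

lemma oddInv_mul_ordinaryHypergeometric_eq_tail {s : ℕ} {b c : ℂ} (hb : b = s + 1 / 2 - N)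
    (hc : c = b + 1) (hζ : ‖ζ‖ < 1) :
    oddInv N s * ζ ^ s * ₂F₁ (1 : ℂ) b c ζ
      = ∑' e, oddInv N e * ζ ^ e - ∑ e ∈ range s, oddInv N e * ζ ^ e := by
  have hodd : ∀ n : ℕ, b + n = -(2 * N - 1 - 2 * (n + s : ℕ)) / 2 := fun n => by
    rw [hb]
    push_cast
    ring
  rw [hc, ordinaryHypergeometric_one_add_one fun n => by
    rw [hodd]
    exact div_ne_zero (neg_ne_zero.2 (odd_ne_zero N _)) two_ne_zero]
  rw [← ((hasSum_nat_add_iff' s).2 (summable_oddInv_mul_pow N hζ).hasSum).tsum_eq,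
    ← tsum_mul_left]
  refine tsum_congr fun n => ?_
  have hs := odd_ne_zero N s
  have hns := odd_ne_zero N (n + s)
  rw [hodd, hb, oddInv, oddInv, pow_add]
  field_simp
  ring

lemma hypergeometric_combination (hN : 1 ≤ N) (hζ : ‖ζ‖ < 1) :
    ζ ^ 2 / (2 * N - 3) * ₂F₁ (1 : ℂ) (3 / 2 - N) (5 / 2 - N) ζ
        + ζ ^ (2 * N) / (2 * N - 1) * ₂F₁ (1 : ℂ) (N - 1 / 2) (N + 1 / 2) ζ
      = ζ * (oddInvPoly N).eval ζ - (ζ - ζ ^ (2 * N)) / (2 * N - 1) := by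
  have htail_one := oddInv_mul_ordinaryHypergeometric_eq_tail (N := N) (s := 1)
    (b := 3 / 2 - N) (c := 5 / 2 - N) (by push_cast; ring) (by ring) hζ
  have htail_last := oddInv_mul_ordinaryHypergeometric_eq_tail (N := N) (s := 2 * N - 1)
    (b := N - 1 / 2) (c := N + 1 / 2) (by rw [Nat.cast_sub (by omega)]; push_cast; ring)
    (by ring) hζ
  have hfirst : oddInv N 0 = (2 * N - 1 : ℂ)⁻¹ := by simp [oddInv]
  have hlast : oddInv N (2 * N - 1) = -(2 * N - 1 : ℂ)⁻¹ := by
    rw [oddInv, Nat.cast_sub (by omega), ← inv_neg]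
    push_cast
    ring_nf
  have hsecond : oddInv N 1 = (2 * N - 3 : ℂ)⁻¹ := by
    rw [oddInv]
    push_cast
    ring_nf
  have hpow : ζ ^ (2 * N) = ζ * ζ ^ (2 * N - 1) := by
    rw [← pow_succ', Nat.sub_add_cancel (by omega)]
  have hsum : (oddInvPoly N).eval ζ
      = ∑ e ∈ range (2 * N - 1), oddInv N e * ζ ^ e - (2 * N - 1 : ℂ)⁻¹ * ζ ^ (2 * N - 1) := by
    rw [eval_oddInvPoly, ← Nat.sub_add_cancel (by omega : 1 ≤ 2 * N), sum_range_succ,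
      Nat.add_sub_cancel, hlast]
    ring
  rw [hlast] at htail_last
  rw [hsecond, sum_range_one, hfirst] at htail_one
  rw [hsum, hpow]
  linear_combination ζ * htail_one - ζ * htail_last

lemma cseClosedForm_eq (hN : 1 ≤ N) (hζ : ‖ζ‖ < 1) :
    cseClosedForm N ζ
      = -(ζ * (oddInvPoly N).eval ζ) * (2 * ζ / (1 - ζ) ^ 2 + (2 * N + 1) / (1 - ζ))
        - ζ * (∑ e ∈ range (2 * N), ζ ^ e) / (1 - ζ) := by
  have hne := one_sub_ne_zero hζ
  have hodd : (2 * N - 1 : ℂ) ≠ 0 := by simpa using odd_ne_zero N 0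
  have hgeom : ∑ e ∈ range (2 * N), ζ ^ e = (1 - ζ ^ (2 * N)) / (1 - ζ) := by
    rw [eq_div_iff hne, mul_comm, mul_neg_geom_sum]
  have hpow : ζ ^ (2 * N - 1) = ζ * ζ ^ (2 * N - 2) := by
    rw [← pow_succ', show 2 * N - 2 + 1 = 2 * N - 1 by omega]
  have hpow' : ζ ^ (2 * N) = ζ ^ 2 * ζ ^ (2 * N - 2) := by
    rw [← pow_add, show 2 + (2 * N - 2) = 2 * N by omega]
  rw [cseClosedForm, hypergeometric_combination hN hζ, hgeom, hpow, hpow']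
  field_simp
  ring

theorem W₂_eq_cseClosedForm (hN : 1 ≤ N) {z₁ z₂ : ℂ} (hz₁ : ‖z₁‖ < 1) (hz₂ : 1 < ‖z₂‖) :
    W₂ N 2 z₁ z₂ = cseClosedForm N (z₁ / z₂) := by
  have hζ : ‖z₁ / z₂‖ < 1 := by
    rw [norm_div, div_lt_one (by linarith)]
    linarith
  rw [cseClosedForm_eq hN hζ]
  exact (hasSum_W₂ zero_le_two hz₁ hz₂).unique (hasSum_structureFactor_two N hζ)

end ClosedForm

section GlobalExpansion

open Finset Polynomial

variable {N : ℕ}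

/-- The Eulerian polynomials of type B, the numerators of the generating functions of the powers
of the odd numbers. -/
def typeBEulerian : ℕ → ℂ[X]
  | 0 => 1
  | m + 1 => (1 + (2 * (m : ℂ[X]) + 1) * X) * typeBEulerian m
      + 2 * X * (1 - X) * derivative (typeBEulerian m)

lemma hasRationalSeries_odd_pow (m : ℕ) :
    HasRationalSeries (fun k => (2 * k + 1 : ℂ) ^ m) (typeBEulerian m) (m + 1) := by
  induction m with
  | zero => exact fun ζ hζ => by simpa [typeBEulerian] using hasSum_geometric_of_norm_lt_one hζ
  | succ m ih =>
    intro ζ hζ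
    have hne := one_sub_ne_zero hζ
    have hvalue : (typeBEulerian (m + 1)).eval ζ / (1 - ζ) ^ (m + 1 + 1)
        = 2 * ((X * ((1 - X) * derivative (typeBEulerian m)
            + ((m + 1 : ℕ) : ℂ[X]) * typeBEulerian m)).eval ζ / (1 - ζ) ^ (m + 1 + 1))
          + (typeBEulerian m).eval ζ / (1 - ζ) ^ (m + 1) := by
      simp only [typeBEulerian, eval_add, eval_mul, eval_sub, eval_one, eval_X, eval_ofNat,
        eval_natCast]
      push_cast
      field_simp
      ring
    rw [hvalue]
    refine (((ih.natCast_mul ζ hζ).mul_left 2).add (ih ζ hζ)).congr_fun fun k => ?_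
    ring

/-- The sum of the `m`-th powers of the first `k` odd numbers. -/
def oddPowerSum (m k : ℕ) : ℂ := ∑ e ∈ range k, (2 * e + 1) ^ m

/-- The numerator, up to a factor `X`, of the generating function of `k * oddPowerSum m k`; these
are the polynomials `p_{m + 1}` of the global expansion. -/
def expansionPoly (m : ℕ) : ℂ[X] :=
  (1 - X) * derivative (X * typeBEulerian m) + ((m + 1 + 1 : ℕ) : ℂ[X]) * (X * typeBEulerian m)

lemma hasRationalSeries_natCast_mul_oddPowerSum (m : ℕ) :
    HasRationalSeries (fun k => k * oddPowerSum m k) (X * expansionPoly m) (m + 3) :=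
  (hasRationalSeries_odd_pow m).sum_range.natCast_mul

/-- The expansion of `structureFactor N 2 k` in powers of `1 / N`, through order `N ^ (-M)`. -/
def structureFactorExpansion (M N k : ℕ) : ℂ :=
  k / 2 * (1 + ∑ m ∈ range M, oddPowerSum m k / (2 * N) ^ (m + 1))

/-- The global expansion of `W₂ N 2` as a function of `ζ = z₁ / z₂`, through order `N ^ (-M)`. -/
def cseExpansion (M N : ℕ) (ζ : ℂ) : ℂ :=
  -2 * (ζ / (1 - ζ) ^ 2
    + ∑ m ∈ range M, ζ * (expansionPoly m).eval ζ / ((2 * N) ^ (m + 1) * (1 - ζ) ^ (m + 3)))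

lemma hasSum_structureFactorExpansion (M N : ℕ) {ζ : ℂ} (hζ : ‖ζ‖ < 1) :
    HasSum (fun k => -4 * (structureFactorExpansion M N k * ζ ^ k)) (cseExpansion M N ζ) := by
  have hlead : HasSum (fun k : ℕ => k * ζ ^ k) (ζ / (1 - ζ) ^ 2) :=
    hasSum_coe_mul_geometric_of_norm_lt_one hζ
  have hterm : ∀ m ∈ range M, HasSum
      (fun k => k * oddPowerSum m k * ζ ^ k / (2 * N) ^ (m + 1))
      (ζ * (expansionPoly m).eval ζ / ((2 * N) ^ (m + 1) * (1 - ζ) ^ (m + 3))) := fun m _ => by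
    rw [mul_comm (_ ^ _), ← div_div]
    simpa using (hasRationalSeries_natCast_mul_oddPowerSum m ζ hζ).div_const ((2 * N) ^ (m + 1))
  refine ((hlead.add (hasSum_sum hterm)).mul_left (-2)).congr_fun fun k => ?_
  simp only [structureFactorExpansion, mul_add, add_mul, mul_sum, sum_mul]
  congr 1
  · ring
  · exact sum_congr rfl fun m _ => by ring

lemma typeBEulerian_zero : typeBEulerian 0 = 1 := rfl

lemma typeBEulerian_one : typeBEulerian 1 = 1 + X := by
  rw [typeBEulerian, typeBEulerian_zero, derivative_one]
  push_cast
  ring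

lemma typeBEulerian_two : typeBEulerian 2 = 1 + 6 * X + X ^ 2 := by
  rw [typeBEulerian, typeBEulerian_one]
  simp only [derivative_add, derivative_X, derivative_one]
  push_cast
  ring

lemma typeBEulerian_three : typeBEulerian 3 = 1 + 23 * X + 23 * X ^ 2 + X ^ 3 := by
  rw [typeBEulerian, typeBEulerian_two]
  simp only [derivative_add, derivative_mul, derivative_X_pow, derivative_X, derivative_one,
    derivative_ofNat, map_natCast]
  push_cast
  ring

lemma typeBEulerian_four : typeBEulerian 4 = 1 + 76 * X + 230 * X ^ 2 + 76 * X ^ 3 + X ^ 4 := by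
  rw [typeBEulerian, typeBEulerian_three]
  simp only [derivative_add, derivative_mul, derivative_X_pow, derivative_X, derivative_one,
    derivative_ofNat, map_natCast]
  push_cast
  ring

lemma typeBEulerian_five :
    typeBEulerian 5 = 1 + 237 * X + 1682 * X ^ 2 + 1682 * X ^ 3
      + 237 * X ^ 4 + X ^ 5 := by
  rw [typeBEulerian, typeBEulerian_four]
  simp only [derivative_add, derivative_mul, derivative_X_pow, derivative_X, derivative_one,
    derivative_ofNat, map_natCast]
  push_cast
  ring

lemma typeBEulerian_six :
    typeBEulerian 6 = 1 + 722 * X + 10543 * X ^ 2 + 23548 * X ^ 3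
      + 10543 * X ^ 4 + 722 * X ^ 5 + X ^ 6 := by
  rw [typeBEulerian, typeBEulerian_five]
  simp only [derivative_add, derivative_mul, derivative_X_pow, derivative_X, derivative_one,
    derivative_ofNat, map_natCast]
  push_cast
  ring

lemma typeBEulerian_seven :
    typeBEulerian 7 = 1 + 2179 * X + 60657 * X ^ 2 + 259723 * X ^ 3 + 259723 * X ^ 4
      + 60657 * X ^ 5 + 2179 * X ^ 6 + X ^ 7 := by
  rw [typeBEulerian, typeBEulerian_six]
  simp only [derivative_add, derivative_mul, derivative_X_pow, derivative_X, derivative_one,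
    derivative_ofNat, map_natCast]
  push_cast
  ring

lemma typeBEulerian_eight :
    typeBEulerian 8 = 1 + 6552 * X + 331612 * X ^ 2 + 2485288 * X ^ 3 + 4675014 * X ^ 4
      + 2485288 * X ^ 5 + 331612 * X ^ 6 + 6552 * X ^ 7 + X ^ 8 := by
  rw [typeBEulerian, typeBEulerian_seven]
  simp only [derivative_add, derivative_mul, derivative_X_pow, derivative_X, derivative_one,
    derivative_ofNat, map_natCast]
  push_cast
  ring

lemma cseExpansion_nine (N : ℕ) (ζ : ℂ) : cseExpansion 9 N ζ = cseGlobalExpansion N ζ := by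
  obtain ⟨w, rfl⟩ : ∃ w, ζ = 1 - w := ⟨1 - ζ, (sub_sub_cancel 1 ζ).symm⟩
  have hw : 1 - w - 1 = -w := sub_sub_cancel_left 1 w
  simp only [cseExpansion, cseGlobalExpansion, expansionPoly, hw, sub_sub_cancel, sum_range_succ,
    sum_range_zero, typeBEulerian_zero, typeBEulerian_one, typeBEulerian_two, typeBEulerian_three,
    typeBEulerian_four, typeBEulerian_five, typeBEulerian_six, typeBEulerian_seven,
    typeBEulerian_eight, derivative_add, derivative_mul, derivative_X_pow, derivative_X,
    derivative_one, derivative_ofNat, eval_add, eval_sub, eval_mul, eval_pow, eval_X, eval_one,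
    eval_zero, eval_ofNat, eval_natCast, map_natCast]
  push_cast
  ring

lemma oddInv_eq_sum_add (hN : N ≠ 0) (M e : ℕ) :
    oddInv N e = ∑ m ∈ range M, (2 * e + 1 : ℂ) ^ m / (2 * N) ^ (m + 1)
      + ((2 * e + 1) / (2 * N)) ^ M * oddInv N e := by
  have hN' : (N : ℂ) ≠ 0 := Nat.cast_ne_zero.2 hN
  have hodd : (2 * N - 1 - 2 * e : ℂ) * oddInv N e = 1 := mul_inv_cancel₀ (odd_ne_zero N e)
  have hgeom := geom_sum_mul ((2 * e + 1) / (2 * N) : ℂ) M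
  have hsum : ∑ m ∈ range M, (2 * e + 1 : ℂ) ^ m / (2 * N) ^ (m + 1)
      = (∑ m ∈ range M, ((2 * e + 1) / (2 * N) : ℂ) ^ m) / (2 * N) := by
    rw [sum_div]
    exact sum_congr rfl fun m _ => by rw [div_pow, div_div, pow_succ]
  have hsub : (2 * e + 1) / (2 * N) - 1 = -(2 * N - 1 - 2 * e : ℂ) / (2 * N) := by
    field_simp
    ring
  rw [hsub] at hgeom
  rw [hsum]
  linear_combination (∑ m ∈ range M, ((2 * e + 1) / (2 * N) : ℂ) ^ m) / (2 * N) * hodd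
    + oddInv N e * hgeom

lemma norm_oddInv_le_div (hN : N ≠ 0) (e : ℕ) : ‖oddInv N e‖ ≤ (e + 1) / N := by
  have hN' : (0 : ℝ) < N := by exact_mod_cast Nat.pos_of_ne_zero hN
  have hmul : N * ‖oddInv N e‖ ≤ e + 1 := by
    have hodd : (2 * N - 1 - 2 * e : ℂ) * oddInv N e = 1 := mul_inv_cancel₀ (odd_ne_zero N e)
    have hN_eq : N * oddInv N e = (1 + (2 * e + 1) * oddInv N e) / 2 := by
      linear_combination hodd / 2
    calc N * ‖oddInv N e‖ = ‖N * oddInv N e‖ := by rw [norm_mul, Complex.norm_natCast]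
      _ = ‖1 + ((2 * e + 1 : ℕ) : ℂ) * oddInv N e‖ / 2 := by
          rw [hN_eq, norm_div, Complex.norm_ofNat]
          push_cast
          rfl
      _ ≤ (1 + (2 * e + 1 : ℕ) * 1) / 2 := by
          gcongr
          refine (norm_add_le _ _).trans ?_
          rw [norm_one, norm_mul, Complex.norm_natCast]
          gcongr
          exact norm_oddInv_le_one N e
      _ = e + 1 := by
          push_cast
          ring
  rwa [le_div_iff₀ hN', mul_comm]

lemma norm_oddHarmonic_le (N k : ℕ) : ‖oddHarmonic N k‖ ≤ k := by
  simpa [oddHarmonic] using norm_sum_le_of_le (range k) fun e _ => norm_oddInv_le_one N e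

lemma norm_oddHarmonic_sub_sum_le (hN : N ≠ 0) (M k : ℕ) :
    ‖oddHarmonic N k - ∑ m ∈ range M, oddPowerSum m k / (2 * N) ^ (m + 1)‖
      ≤ k * (k / N : ℝ) ^ (M + 1) := by
  have hN' : (0 : ℝ) < N := by exact_mod_cast Nat.pos_of_ne_zero hN
  have hremainder : oddHarmonic N k - ∑ m ∈ range M, oddPowerSum m k / (2 * N) ^ (m + 1)
      = ∑ e ∈ range k, ((2 * e + 1) / (2 * N) : ℂ) ^ M * oddInv N e := by
    simp only [oddHarmonic, oddPowerSum, sum_div]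
    rw [sum_comm, ← sum_sub_distrib]
    exact sum_congr rfl fun e _ => sub_eq_iff_eq_add'.2 (oddInv_eq_sum_add hN M e)
  have hterm : ∀ e ∈ range k, ‖((2 * e + 1) / (2 * N) : ℂ) ^ M * oddInv N e‖
      ≤ (k / N : ℝ) ^ (M + 1) := fun e he => by
    have hek : (e : ℝ) + 1 ≤ k := by exact_mod_cast mem_range.1 he
    have hratio : ‖(2 * e + 1) / (2 * N : ℂ)‖ ≤ k / N := by
      have hcast : (2 * e + 1) / (2 * N : ℂ) = ((2 * e + 1 : ℕ) : ℂ) / ((2 * N : ℕ) : ℂ) := by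
        push_cast
        rfl
      rw [hcast, norm_div, Complex.norm_natCast, Complex.norm_natCast]
      push_cast
      rw [div_le_div_iff₀ (by positivity) hN']
      nlinarith
    rw [norm_mul, norm_pow, pow_succ]
    gcongr
    exact (norm_oddInv_le_div hN e).trans (by gcongr)
  rw [hremainder]
  simpa using norm_sum_le_of_le (range k) hterm

lemma norm_structureFactor_two_sub_le (hN : N ≠ 0) (M k : ℕ) :
    ‖structureFactor N 2 k - k / 2 * (1 + oddHarmonic N k)‖
      ≤ k ^ 2 * (k / N : ℝ) ^ (M + 1) := by
  have hN' : (0 : ℝ) < N := by exact_mod_cast Nat.pos_of_ne_zero hN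
  rw [structureFactor_two]
  rcases le_total k (2 * N) with hk | hk
  · rw [min_eq_left hk, show ((k : ℂ) + k * oddHarmonic N k) / 2 - k / 2 * (1 + oddHarmonic N k) = 0
      by ring, norm_zero]
    positivity
  · have hNk : (2 * N : ℝ) ≤ k := by exact_mod_cast hk
    have hk1 : (1 : ℝ) ≤ k := by
      have : (1 : ℝ) ≤ N := by exact_mod_cast Nat.one_le_iff_ne_zero.2 hN
      linarith
    have hratio : (1 : ℝ) ≤ (k / N) ^ (M + 1) :=
      one_le_pow₀ ((one_le_div hN').2 (by linarith))
    rw [min_eq_right hk, oddHarmonic_two_mul]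
    have hsplit : (((2 * N : ℕ) : ℂ) + k * 0) / 2 - k / 2 * (1 + oddHarmonic N k)
        = -(((k - 2 * N : ℕ) : ℂ) + k * oddHarmonic N k) / 2 := by
      rw [Nat.cast_sub hk]
      ring
    have hdiff : ((k - 2 * N : ℕ) : ℝ) ≤ k := by exact_mod_cast Nat.sub_le _ _
    rw [hsplit, norm_div, norm_neg, Complex.norm_ofNat]
    calc ‖((k - 2 * N : ℕ) : ℂ) + k * oddHarmonic N k‖ / 2
        ≤ (k + k * k) / 2 := by
          gcongr
          refine (norm_add_le _ _).trans ?_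
          rw [norm_mul, Complex.norm_natCast, Complex.norm_natCast]
          gcongr
          exact norm_oddHarmonic_le N k
      _ ≤ (k : ℝ) ^ 2 := by nlinarith
      _ ≤ k ^ 2 * (k / N : ℝ) ^ (M + 1) := le_mul_of_one_le_right (by positivity) hratio

lemma norm_structureFactor_two_sub_expansion_le (hN : N ≠ 0) (M k : ℕ) :
    ‖structureFactor N 2 k - structureFactorExpansion M N k‖
      ≤ 2 * (k ^ 2 * (k / N : ℝ) ^ (M + 1)) := by
  have hharmonic : ‖k / 2 * (1 + oddHarmonic N k) - structureFactorExpansion M N k‖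
      ≤ k ^ 2 * (k / N : ℝ) ^ (M + 1) := by
    rw [structureFactorExpansion, ← mul_sub, add_sub_add_left_eq_sub, norm_mul, norm_div,
      Complex.norm_natCast, Complex.norm_ofNat]
    calc (k : ℝ) / 2 * _ ≤ k * (k * (k / N : ℝ) ^ (M + 1)) :=
          mul_le_mul (half_le_self k.cast_nonneg) (norm_oddHarmonic_sub_sum_le hN M k)
            (norm_nonneg _) k.cast_nonneg
      _ = k ^ 2 * (k / N : ℝ) ^ (M + 1) := by ring
  rw [two_mul]
  exact (norm_sub_le_norm_sub_add_norm_sub _ _ _).trans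
    (add_le_add (norm_structureFactor_two_sub_le hN M k) hharmonic)

theorem exists_norm_W₂_sub_cseExpansion_le (M : ℕ) {r : ℝ} (hr0 : 0 ≤ r) (hr1 : r < 1) :
    ∃ C : ℝ, ∀ N : ℕ, 1 ≤ N → ∀ z₁ z₂ : ℂ, ‖z₁‖ < 1 → 1 < ‖z₂‖ → ‖z₁ / z₂‖ ≤ r →
      ‖W₂ N 2 z₁ z₂ - cseExpansion M N (z₁ / z₂)‖ ≤ C / (N : ℝ) ^ (M + 1) := by
  have hsummable : Summable fun k : ℕ => (k : ℝ) ^ (M + 3) * r ^ k :=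
    summable_pow_mul_geometric_of_norm_lt_one (M + 3) (by rwa [Real.norm_of_nonneg hr0])
  refine ⟨8 * ∑' k : ℕ, (k : ℝ) ^ (M + 3) * r ^ k, fun N hN z₁ z₂ hz₁ hz₂ hζ => ?_⟩
  have hdiff := (hasSum_W₂ (N := N) zero_le_two hz₁ hz₂).sub
    (hasSum_structureFactorExpansion M N (hζ.trans_lt hr1))
  rw [← hdiff.tsum_eq, mul_div_right_comm]
  refine tsum_of_norm_bounded (hsummable.hasSum.mul_left _) fun k => ?_
  calc ‖-4 * (structureFactor N 2 k * (z₁ / z₂) ^ k)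
        - -4 * (structureFactorExpansion M N k * (z₁ / z₂) ^ k)‖
      = 4 * ‖structureFactor N 2 k - structureFactorExpansion M N k‖ * ‖z₁ / z₂‖ ^ k := by
        rw [← mul_sub, ← sub_mul, norm_mul, norm_mul, norm_pow, norm_neg, Complex.norm_ofNat,
          mul_assoc]
    _ ≤ 4 * (2 * (k ^ 2 * (k / N : ℝ) ^ (M + 1))) * r ^ k := by
        gcongr
        exact norm_structureFactor_two_sub_expansion_le (Nat.one_le_iff_ne_zero.1 hN) M k
    _ = 8 / (N : ℝ) ^ (M + 1) * ((k : ℝ) ^ (M + 3) * r ^ k) := by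
        rw [div_pow]
        ring

end GlobalExpansion

end CircularEnsemble

end

theorem proposition5p2 :
    -- the exact form in the `(0, ∞)` domain, with `κ = 2` (`β = 4`) and `ζ = z₁ / z₂`
    (∀ (N : ℕ), 1 ≤ N → ∀ (z₁ z₂ : ℂ), ‖z₁‖ < 1 → 1 < ‖z₂‖ →
      CircularEnsemble.W₂ N 2 z₁ z₂ = CircularEnsemble.cseClosedForm N (z₁ / z₂)) ∧
    -- the global expansion, with an error of order `N ^ (-10)` uniformly on compact sets of `ζ`
    (∀ (r : ℝ), 0 ≤ r → r < 1 → ∃ C : ℝ, ∀ (N : ℕ), 1 ≤ N → ∀ (z₁ z₂ : ℂ),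
      ‖z₁‖ < 1 → 1 < ‖z₂‖ → ‖z₁ / z₂‖ ≤ r →
      ‖CircularEnsemble.W₂ N 2 z₁ z₂ - CircularEnsemble.cseGlobalExpansion N (z₁ / z₂)‖
        ≤ C / (N : ℝ) ^ 10) :=
  ⟨fun _ hN _ _ hz₁ hz₂ => CircularEnsemble.W₂_eq_cseClosedForm hN hz₁ hz₂, fun _ hr0 hr1 => by
    simpa only [CircularEnsemble.cseExpansion_nine] using
      CircularEnsemble.exists_norm_W₂_sub_cseExpansion_le 9 hr0 hr1⟩
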